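/- Let $N\ge 1$, $R>0$, let $B_R$ be the open ball of radius $R$ centred at the origin of $\mathbb{R}^N$, let $\varphi_N(x)=(2\pi)^{-N/2}e^{-|x|^2/2}$ and $d\gamma_N=\varphi_N\,dx$. Consider the Neumann eigenvalue problem $$-\operatorname{div}(\varphi_N\nabla u)=\mu\,\varphi_N u\ \text{ in } B_R,\qquad \frac{\partial u}{\partial r}=0\ \text{ on }\partial B_R,$$ understood in the weak sense: $u$ is an eigenfunction with eigenvalue $\mu$ if $0\neq u\in H^1(B_R,\gamma_N)$ and $\int_{B_R}\nabla u\cdot\nabla v\,d\gamma_N=\mu\int_{B_R}uv\,d\gamma_N$ for all $v\in H^1(B_R,\gamma_N)$, where $H^1(B_R,\gamma_N)$ is the space of $u\in W^{1,1}_{\rm loc}(B_R)$ with $u,|\nabla u|\in L^2(B_R,\gamma_N)$. An eigenvalue is called radial if it has an eigenfunction of the form $f(|x|)$; it is called non-radial, of angular mode $k\ge1$, if it has an eigenfunction of the form $f(|x|)\,Y(x/|x|)$ with $Y$ a spherical harmonic of degree $k$ (the restriction to the unit sphere of a homogeneous harmonic polynomial of degree $k$). Then there is a smallest non-radial eigenvalue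 $\nu_1(R)$ (among all modes $k\ge1$), there is a smallest nonzero radial eigenvalue $\tau_1(R)$, $\nu_1(R)$ is also the smallest eigenvalue of angular mode $k=1$, and $$\nu_1(R)<\tau_1(R).$$ Moreover $\nu_1(R)$ is the smallest nonzero eigenvalue of the problem, and there is a function $w\in C^2([0,R])$, positive on $(0,R]$ and nondecreasing on $[0,R]$, with $$w''+w'\Big(\frac{N-1}{r}-r\Big)+\nu_1(R)\,w-\frac{N-1}{r^2}\,w=0\ \text{ in }(0,R),\qquad w(0)=w'(R)=0,$$ such that the eigenfunctions with eigenvalue $\nu_1(R)$ are (up to equality a.e.) exactly the functions $w(|x|)\,Y(x/|x|)$, where $Y$ is a spherical harmonic of degree $1$, not identically zero. -/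

import Mathlib

open MeasureTheory Metric Set
open scoped ContDiff

namespace GaussNeumann

/-- Euclidean space of dimension `N`. -/
abbrev E (N : ℕ) : Type := EuclideanSpace ℝ (Fin N)

/-- The density `(2π)^(-N/2) exp(-|x|²/2)` of the normalized Gaussian measure. -/
noncomputable def gaussDensity (N : ℕ) (x : E N) : ℝ :=
  (2 * Real.pi) ^ (-(N : ℝ) / 2) * Real.exp (-‖x‖ ^ 2 / 2)

/-- The normalized Gaussian measure on `ℝ^N`. -/
noncomputable def gauss (N : ℕ) : Measure (E N) :=
  volume.withDensity fun x => ENNReal.ofReal (gaussDensity N x)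

/-- `u ∈ W^{1,1}_loc(Ω)` with weak gradient `G` (tested against smooth functions with compact
support in `Ω`, in every direction `e`). -/
def HasWeakGradient {N : ℕ} (Ω : Set (E N)) (u : E N → ℝ) (G : E N → E N) : Prop :=
  LocallyIntegrableOn u Ω ∧ LocallyIntegrableOn G Ω ∧
    ∀ φ : E N → ℝ, ContDiff ℝ ∞ φ → HasCompactSupport φ → tsupport φ ⊆ Ω →
      ∀ e : E N, ∫ x in Ω, u x * fderiv ℝ φ x e = -∫ x in Ω, inner ℝ (G x) e * φ x

/-- `u` belongs to the Gaussian Sobolev space `H¹(Ω, γ_N)` and `G` is its weak gradient. -/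
def MemH1 {N : ℕ} (Ω : Set (E N)) (u : E N → ℝ) (G : E N → E N) : Prop :=
  HasWeakGradient Ω u G ∧ MemLp u 2 ((gauss N).restrict Ω) ∧ MemLp G 2 ((gauss N).restrict Ω)

/-- `u ∈ H¹(Ω, γ_N)` is an eigenfunction, with eigenvalue `μ`, of the Neumann problem
`-div(φ_N ∇u) = μ φ_N u` in `Ω`, `∂u/∂ν = 0` on `∂Ω`. The problem is understood weakly; the boundary
condition is the natural one, encoded by letting the test functions `v` range over all of `H¹`. -/
def IsNeumannEigenfunction {N : ℕ} (Ω : Set (E N)) (μ : ℝ) (u : E N → ℝ) : Prop :=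
  ¬ (u =ᵐ[(gauss N).restrict Ω] 0) ∧
    ∃ G : E N → E N, MemH1 Ω u G ∧
      ∀ (v : E N → ℝ) (H : E N → E N), MemH1 Ω v H →
        ∫ x in Ω, inner ℝ (G x) (H x) ∂(gauss N) = μ * ∫ x in Ω, u x * v x ∂(gauss N)

/-- The Neumann eigenvalues of the ball `B_R` centred at the origin. -/
def eigenvalues (N : ℕ) (R : ℝ) : Set ℝ :=
  {μ | ∃ u : E N → ℝ, IsNeumannEigenfunction (ball 0 R) μ u}

/-- The eigenvalues of `B_R` that have a purely radial eigenfunction. -/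
def radialEigenvalues (N : ℕ) (R : ℝ) : Set ℝ :=
  {μ | ∃ f : ℝ → ℝ, IsNeumannEigenfunction (ball (0 : E N) R) μ fun x => f ‖x‖}

/-- `Y` is, on the unit sphere, a spherical harmonic of degree `k`: the restriction of a homogeneous
harmonic polynomial of degree `k`. (Values of `Y` off the unit sphere are irrelevant.) -/
def IsSphericalHarmonic {N : ℕ} (k : ℕ) (Y : E N → ℝ) : Prop :=
  ∃ P : MvPolynomial (Fin N) ℝ, P.IsHomogeneous k ∧
    ∑ i, MvPolynomial.pderiv i (MvPolynomial.pderiv i P) = 0 ∧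
    ∀ θ ∈ sphere (0 : E N) 1, Y θ = MvPolynomial.eval (fun i => θ i) P

/-- The function `f(r) Y(θ)` in polar coordinates `x = rθ`, `r = |x|`. -/
noncomputable def polarProduct {N : ℕ} (f : ℝ → ℝ) (Y : E N → ℝ) (x : E N) : ℝ :=
  f ‖x‖ * Y (‖x‖⁻¹ • x)

/-- The eigenvalues of `B_R` that have an eigenfunction `f(r) Y(θ)` of angular mode `k`, that is,
with `Y` a spherical harmonic of degree `k`. -/
def modeEigenvalues (N : ℕ) (R : ℝ) (k : ℕ) : Set ℝ :=
  {μ | ∃ (f : ℝ → ℝ) (Y : E N → ℝ), IsSphericalHarmonic k Y ∧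
    IsNeumannEigenfunction (ball 0 R) μ (polarProduct f Y)}

/-- The non-radial eigenvalues of `B_R`: those of some angular mode `k ≥ 1`. -/
def nonradialEigenvalues (N : ℕ) (R : ℝ) : Set ℝ :=
  {μ | ∃ k : ℕ, 1 ≤ k ∧ μ ∈ modeEigenvalues N R k}

end GaussNeumann

namespace GaussNeumann

/-! The proof reduces everything to explicit power series; it uses neither compactness of an
embedding of `H¹` nor elliptic regularity. If `P` is a harmonic polynomial, homogeneous of degree
`k`, then `Δ - x · ∇` maps `g(|x|²) P` to `h(|x|²) P` with `h = 4 s g'' + (4 b - 2 s) g' - k g` and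
`b = N/2 + k` (`ouOp_modeFun`). In mode `k` the eigenvalue equation is thus a Kummer equation. Its
regular solution is the entire function `profile N k μ`, and the Neumann condition says that
`neumannTrace k (profile N k μ)` vanishes at `R²`. Call mode `k` resonant at `μ` when this happens.

A resonance gives an explicit smooth eigenfunction (`isNeumannEigenfunction_modeFun`). Without
resonance, the Kummer equation with any polynomial right-hand side `p` has an entire solution
satisfying the Neumann condition; Green's formula (`MemH1.green`) then makes every eigenfunction
orthogonal to `p(|x|²) P`. Such products span all polynomials, which are dense, so an eigenfunction
vanishes if no mode is resonant (`ae_eq_zero_of_orthogonal_harmonic`).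

It remains to locate the resonances (`exists_neumann_parameters`). Let `ν` be the first parameter
for which the derivative of `w = r g(r²)`, with `g` the profile of mode one, touches zero on `[0,
R]`. A second order test shows that it does so at `r = R`, so `w` is nondecreasing and satisfies the
Neumann condition. The derivative of the radial profile at `μ` is a multiple of the profile of mode
one at `μ - 1`; hence `τ = l + 1`, where `l` is the lowest Dirichlet parameter of mode one, and `ν <
l` because a nondecreasing `w` cannot vanish at `R`. Modes `k ≥ 2` are compared with `w`: their
larger centrifugal term excludes resonance up to and including `ν`.

At `ν` only mode one is resonant. There a Fredholm type argument
(`IsVeryWeakSolution.ae_eq_modeFun`) shows that subtracting a suitable `g(|x|²)` times a linear form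
leaves nothing. -/

/-! ### Entire power series -/

/-- Coefficient sequences dominated by those of an exponential. -/
def ExpBounded (c : ℕ → ℝ) : Prop :=
  ∃ C K : ℝ, 0 ≤ C ∧ 0 ≤ K ∧ ∀ j : ℕ, |c j| ≤ C * (K ^ j / (j.factorial : ℝ))

/-- The sum of the power series with coefficients `c`. -/
noncomputable def powerSum (c : ℕ → ℝ) (s : ℝ) : ℝ := ∑' j, c j * s ^ j

/-- The coefficients of the derived power series. -/
def derivCoeff (c : ℕ → ℝ) (j : ℕ) : ℝ := ((j : ℝ) + 1) * c (j + 1)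

lemma ExpBounded.derivCoeff {c : ℕ → ℝ} (hc : ExpBounded c) : ExpBounded (derivCoeff c) := by
  obtain ⟨C, K, hC, hK, h⟩ := hc
  refine ⟨C * K, K, by positivity, hK, fun j => ?_⟩
  have h1 := h (j + 1)
  have h2 : (0 : ℝ) < (j : ℝ) + 1 := by positivity
  have h3 : (0 : ℝ) < (j.factorial : ℝ) := by positivity
  rw [GaussNeumann.derivCoeff, abs_mul, abs_of_pos h2]
  calc ((j : ℝ) + 1) * |c (j + 1)|
      ≤ ((j : ℝ) + 1) * (C * (K ^ (j + 1) / ((j + 1).factorial : ℝ))) := by gcongr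
    _ = C * K * (K ^ j / (j.factorial : ℝ)) := by
        rw [Nat.factorial_succ]; push_cast; field_simp; ring

lemma ExpBounded.summable_bound {c : ℕ → ℝ} (hc : ExpBounded c) (ρ : ℝ) :
    Summable fun j => |c j| * |ρ| ^ j := by
  obtain ⟨C, K, hC, hK, h⟩ := hc
  have h1 := (Real.summable_pow_div_factorial (K * |ρ|)).mul_left C
  refine Summable.of_nonneg_of_le (fun j => by positivity) (fun j => ?_) h1
  calc |c j| * |ρ| ^ j ≤ C * (K ^ j / (j.factorial : ℝ)) * |ρ| ^ j := by gcongr; exact h j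
    _ = C * ((K * |ρ|) ^ j / (j.factorial : ℝ)) := by rw [mul_pow]; ring

lemma ExpBounded.summable {c : ℕ → ℝ} (hc : ExpBounded c) (s : ℝ) :
    Summable fun j => c j * s ^ j := by
  refine Summable.of_norm ?_
  simpa [abs_mul] using hc.summable_bound s

lemma ExpBounded.hasSum {c : ℕ → ℝ} (hc : ExpBounded c) (s : ℝ) :
    HasSum (fun j => c j * s ^ j) (powerSum c s) := (hc.summable s).hasSum

lemma powerSum_zero (c : ℕ → ℝ) : powerSum c 0 = c 0 := by
  rw [powerSum, tsum_eq_single 0 (fun j hj => by simp [hj])]; simp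

lemma ExpBounded.hasDerivAt {c : ℕ → ℝ} (hc : ExpBounded c) (s : ℝ) :
    HasDerivAt (powerSum c) (powerSum (GaussNeumann.derivCoeff c) s) s := by
  have key : ∀ y, HasSum (fun j : ℕ => c j * ((j : ℝ) * y ^ (j - 1)))
      (powerSum (GaussNeumann.derivCoeff c) y) := by
    intro y
    rw [← hasSum_nat_add_iff' 1]
    simpa [GaussNeumann.derivCoeff, mul_comm, mul_left_comm, mul_assoc]
      using hc.derivCoeff.hasSum y
  have hbound : Summable fun j : ℕ => |c j| * ((j : ℝ) * (|s| + 1) ^ (j - 1)) := by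
    rw [← summable_nat_add_iff 1]
    have := hc.derivCoeff.summable_bound (|s| + 1)
    refine this.congr fun j => ?_
    have h2 : (0 : ℝ) ≤ (j : ℝ) + 1 := by positivity
    rw [GaussNeumann.derivCoeff, abs_mul, abs_of_nonneg h2,
      abs_of_nonneg (by positivity : 0 ≤ |s| + 1)]
    push_cast
    ring
  rw [← (key s).tsum_eq]
  -- The radius `|s| + 1` gives a connected open set containing both `s` and the point `0` where
  -- convergence is trivial.
  refine hasDerivAt_tsum_of_isPreconnected (t := ball 0 (|s| + 1)) (y₀ := 0) hbound isOpen_ball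
    (convex_ball _ _).isPreconnected (fun j y _ => (hasDerivAt_pow j y).const_mul (c j))
    (fun j y hy => ?_) (by simp; positivity) (hc.summable 0) (by simp)
  have hy' : |y| ≤ |s| + 1 := by simpa using (mem_ball_zero_iff.1 hy).le
  rw [norm_mul, norm_mul, norm_pow, Real.norm_eq_abs, Real.norm_eq_abs, Real.norm_eq_abs,
    Nat.abs_cast]
  gcongr

lemma ExpBounded.deriv {c : ℕ → ℝ} (hc : ExpBounded c) :
    deriv (powerSum c) = powerSum (GaussNeumann.derivCoeff c) :=
  funext fun s => (hc.hasDerivAt s).deriv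

lemma ExpBounded.continuous {c : ℕ → ℝ} (hc : ExpBounded c) : Continuous (powerSum c) :=
  continuous_iff_continuousAt.2 fun s => (hc.hasDerivAt s).continuousAt

lemma ExpBounded.contDiff {c : ℕ → ℝ} (hc : ExpBounded c) : ContDiff ℝ ∞ (powerSum c) := by
  rw [contDiff_infty]
  intro n
  induction n generalizing c with
  | zero => exact contDiff_zero.2 hc.continuous
  | succ n ih =>
    push_cast
    rw [contDiff_succ_iff_deriv]
    refine ⟨fun s => (hc.hasDerivAt s).differentiableAt, by simp, ?_⟩
    rw [hc.deriv]; exact ih hc.derivCoeff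

/-! ### The confluent hypergeometric equation with polynomial right-hand side -/

/-- Coefficients of the entire solution `g` of `4 s g'' + (4 b - 2 s) g' - a g = h`, `g 0 = c₀`. -/
noncomputable def kummerCoeff (a b c₀ : ℝ) (h : Polynomial ℝ) : ℕ → ℝ
  | 0 => c₀
  | j + 1 => ((a + 2 * j) * kummerCoeff a b c₀ h j + h.coeff j) / (4 * (j + 1) * (j + b))

lemma kummerCoeff_zero (a b c₀ : ℝ) (h : Polynomial ℝ) : kummerCoeff a b c₀ h 0 = c₀ := rfl

lemma kummerCoeff_succ (a b c₀ : ℝ) (h : Polynomial ℝ) (j : ℕ) : kummerCoeff a b c₀ h (j + 1) =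
    ((a + 2 * j) * kummerCoeff a b c₀ h j + h.coeff j) / (4 * (j + 1) * (j + b)) := rfl

/-- The recursion is dominated by that of the exponential series with constant `|a| + 1`, which
makes its solutions entire. The bound on `b` serves the case `j = 0`. -/
lemma kummer_ratio_le {a b : ℝ} (hb : 1 / 2 ≤ b) (j : ℕ) :
    |a + 2 * j| / (4 * (j + 1) * (j + b)) ≤ (|a| + 1) / (j + 1) := by
  have hj : (0 : ℝ) ≤ j := j.cast_nonneg
  have h0 : |a + 2 * j| ≤ |a| + 2 * j := by
    calc |a + 2 * j| ≤ |a| + |2 * (j : ℝ)| := abs_add_le _ _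
      _ = _ := by rw [abs_of_nonneg (by positivity : 0 ≤ 2 * (j : ℝ))]
  have h1 : |a + 2 * j| ≤ (|a| + 1) * (4 * (j + b)) := by
    have ha := abs_nonneg a
    rcases Nat.eq_zero_or_pos j with rfl | hj'
    · simp at h0 ⊢; nlinarith
    · have : (1 : ℝ) ≤ j := by exact_mod_cast hj'
      nlinarith
  rw [div_le_div_iff₀ (by positivity) (by positivity)]
  calc |a + 2 * j| * (j + 1) ≤ (|a| + 1) * (4 * (j + b)) * (j + 1) := by gcongr
    _ = _ := by ring

lemma expBounded_of_eventually {c : ℕ → ℝ} {K : ℝ} (hK : 0 < K) (n : ℕ)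
    (h : ∀ j ≥ n, |c (j + 1)| ≤ K / (j + 1) * |c j|) : ExpBounded c := by
  -- A sum of nonnegative terms bounds each of them, so this constant handles all indices up to `n`
  -- at once.
  set C := ∑ i ∈ Finset.range (n + 1), |c i| / (K ^ i / (i.factorial : ℝ)) with hC
  refine ⟨C, K, Finset.sum_nonneg fun i _ => by positivity, hK.le, fun j => ?_⟩
  rcases le_or_gt j n with hj | hj
  · have h1 : |c j| / (K ^ j / (j.factorial : ℝ)) ≤ C :=
      Finset.single_le_sum (f := fun i => |c i| / (K ^ i / (i.factorial : ℝ)))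
        (fun i _ => by positivity) (Finset.mem_range.2 (by omega))
    exact (div_le_iff₀ (by positivity)).1 h1
  · induction j, hj.le using Nat.le_induction with
    | base => omega
    | succ j hj' ih =>
      have h2 : |c j| ≤ C * (K ^ j / (j.factorial : ℝ)) := by
        rcases eq_or_lt_of_le hj' with rfl | h3
        · have h1 : |c n| / (K ^ n / (n.factorial : ℝ)) ≤ C :=
            Finset.single_le_sum (f := fun i => |c i| / (K ^ i / (i.factorial : ℝ)))
              (fun i _ => by positivity) (Finset.mem_range.2 (by omega))
          exact (div_le_iff₀ (by positivity)).1 h1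
        · exact ih h3
      calc |c (j + 1)| ≤ K / (j + 1) * |c j| := h j hj'
        _ ≤ K / (j + 1) * (C * (K ^ j / (j.factorial : ℝ))) := by gcongr
        _ = _ := by rw [Nat.factorial_succ]; push_cast; field_simp; ring

lemma kummerCoeff_expBounded (a : ℝ) {b : ℝ} (hb : 1 / 2 ≤ b) (c₀ : ℝ) (h : Polynomial ℝ) :
    ExpBounded (kummerCoeff a b c₀ h) := by
  refine expBounded_of_eventually (K := |a| + 1) (by positivity) (h.natDegree + 1) fun j hj => ?_
  have hb' : 0 < (j : ℝ) + b := by have : (0 : ℝ) ≤ j := j.cast_nonneg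
                                   linarith
  rw [kummerCoeff_succ, h.coeff_eq_zero_of_natDegree_lt (by omega), add_zero, abs_div, abs_mul,
    abs_of_pos (by positivity : 0 < 4 * ((j : ℝ) + 1) * (j + b)), mul_div_right_comm]
  exact mul_le_mul_of_nonneg_right (kummer_ratio_le hb j) (abs_nonneg _)

/-- The explicit dependence on `a` makes the bound uniform for bounded `a`, as needed for continuity
in the parameter. -/
lemma kummerCoeff_hom_bound (a : ℝ) {b : ℝ} (hb : 1 / 2 ≤ b) (j : ℕ) :
    |kummerCoeff a b 1 0 j| ≤ (|a| + 1) ^ j / (j.factorial : ℝ) := by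
  induction j with
  | zero => simp [kummerCoeff_zero]
  | succ j ih =>
    have hb' : 0 < (j : ℝ) + b := by have : (0 : ℝ) ≤ j := j.cast_nonneg
                                     linarith
    rw [kummerCoeff_succ, Polynomial.coeff_zero, add_zero, abs_div, abs_mul,
      abs_of_pos (by positivity : 0 < 4 * ((j : ℝ) + 1) * (j + b)), mul_div_right_comm]
    calc _ ≤ (|a| + 1) / (j + 1) * ((|a| + 1) ^ j / (j.factorial : ℝ)) := by
          exact mul_le_mul (kummer_ratio_le hb j) ih (abs_nonneg _) (by positivity)
      _ = _ := by rw [Nat.factorial_succ]; push_cast; field_simp; ring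

lemma kummer_ode (a : ℝ) {b : ℝ} (hb : 1 / 2 ≤ b) (c₀ : ℝ) (h : Polynomial ℝ) (s : ℝ) :
    4 * s * powerSum (derivCoeff (derivCoeff (kummerCoeff a b c₀ h))) s
      + (4 * b - 2 * s) * powerSum (derivCoeff (kummerCoeff a b c₀ h)) s
      - a * powerSum (kummerCoeff a b c₀ h) s = h.eval s := by
  set c := kummerCoeff a b c₀ h with hc
  have hE : ExpBounded c := kummerCoeff_expBounded a hb c₀ h
  have h0 := hE.hasSum s
  have h1 := hE.derivCoeff.hasSum s
  have h2 := hE.derivCoeff.derivCoeff.hasSum s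
  have h1s : HasSum (fun j : ℕ => (j : ℝ) * c j * s ^ j) (s * powerSum (derivCoeff c) s) := by
    rw [← hasSum_nat_add_iff' 1]
    have := h1.mul_left s
    simp only [Finset.range_one, Finset.sum_singleton, Nat.cast_zero, zero_mul, sub_zero]
    refine this.congr_fun ?_ |> fun h => h
    intro j
    simp only [derivCoeff]; push_cast; ring
  have h2s : HasSum (fun j : ℕ => (j : ℝ) * derivCoeff c j * s ^ j)
      (s * powerSum (derivCoeff (derivCoeff c)) s) := by
    rw [← hasSum_nat_add_iff' 1]
    have := h2.mul_left s
    simp only [Finset.range_one, Finset.sum_singleton, Nat.cast_zero, zero_mul, sub_zero]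
    refine this.congr_fun ?_ |> fun h => h
    intro j
    simp only [derivCoeff]; push_cast; ring
  have hp : HasSum (fun j : ℕ => h.coeff j * s ^ j) (h.eval s) := by
    rw [Polynomial.eval_eq_sum_range]
    refine hasSum_sum_of_ne_finset_zero fun j hj => ?_
    rw [h.coeff_eq_zero_of_natDegree_lt (by simpa [Nat.lt_succ_iff] using hj), zero_mul]
  have hT := (((h2s.mul_left 4).add (h1.mul_left (4 * b))).sub (h1s.mul_left 2)).sub
    (h0.mul_left a)
  have hT' : HasSum (fun j : ℕ => h.coeff j * s ^ j)
      (4 * (s * powerSum (derivCoeff (derivCoeff c)) s) + 4 * b * powerSum (derivCoeff c) s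
        - 2 * (s * powerSum (derivCoeff c) s) - a * powerSum c s) := by
    refine hT.congr_fun ?_ |> fun h => h
    intro j
    have hb' : 0 < (j : ℝ) + b := by have : (0 : ℝ) ≤ j := j.cast_nonneg
                                     linarith
    -- The recursion is the comparison of the coefficients of `s ^ j` in the equation.
    have e : 4 * (j + 1) * (j + b) * c (j + 1) = (a + 2 * j) * c j + h.coeff j := by
      rw [hc, kummerCoeff_succ]; field_simp
    simp only [derivCoeff]
    linear_combination (-s ^ j) * e
  rw [hp.unique hT']; ring

/-- The entire solution of `4 s g'' + (4 b - 2 s) g' = a g` with `g 0 = 1`. -/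
noncomputable def kummer (a b s : ℝ) : ℝ := powerSum (kummerCoeff a b 1 0) s

lemma kummer_zero (a b : ℝ) : kummer a b 0 = 1 := by
  simp [kummer, powerSum_zero, kummerCoeff_zero]

/-- Differentiating the equation gives one of the same type with `a + 2` and `b + 1`. This links the
radial mode to mode one and gives joint continuity of derivatives in the parameter and `s`. -/
lemma derivCoeff_kummerCoeff (a : ℝ) {b : ℝ} (hb : 1 / 2 ≤ b) (j : ℕ) :
    derivCoeff (kummerCoeff a b 1 0) j = a / (4 * b) * kummerCoeff (a + 2) (b + 1) 1 0 j := by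
  induction j with
  | zero => simp [derivCoeff, kummerCoeff_succ, kummerCoeff_zero]
  | succ j ih =>
    have hj : (0 : ℝ) ≤ j := j.cast_nonneg
    have hb' : (j : ℝ) + (b + 1) ≠ 0 := by positivity
    have hb'' : (j : ℝ) + 1 + b ≠ 0 := by positivity
    rw [derivCoeff, kummerCoeff_succ a b, kummerCoeff_succ (a + 2), mul_div_assoc',
      ← mul_div_assoc, Polynomial.coeff_zero, Polynomial.coeff_zero, add_zero, add_zero,
      mul_left_comm (a / (4 * b)), ← ih, derivCoeff]
    push_cast
    field_simp
    ring

lemma hasDerivAt_kummer (a : ℝ) {b : ℝ} (hb : 1 / 2 ≤ b) (s : ℝ) :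
    HasDerivAt (kummer a b) (a / (4 * b) * kummer (a + 2) (b + 1) s) s := by
  have e : a / (4 * b) * kummer (a + 2) (b + 1) s
      = powerSum (derivCoeff (kummerCoeff a b 1 0)) s := by
    rw [kummer, powerSum, powerSum, ← tsum_mul_left]
    exact tsum_congr fun j => by rw [derivCoeff_kummerCoeff a hb]; ring
  rw [e]
  exact (kummerCoeff_expBounded a hb 1 0).hasDerivAt s

lemma contDiff_kummer (a : ℝ) {b : ℝ} (hb : 1 / 2 ≤ b) : ContDiff ℝ ∞ (kummer a b) :=
  (kummerCoeff_expBounded a hb 1 0).contDiff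

lemma deriv_kummer (a : ℝ) {b : ℝ} (hb : 1 / 2 ≤ b) :
    deriv (kummer a b) = fun s => a / (4 * b) * kummer (a + 2) (b + 1) s :=
  funext fun s => (hasDerivAt_kummer a hb s).deriv

/-- Every polynomial right-hand side admits an entire solution. -/
lemma exists_kummer_inhomogeneous (a : ℝ) {b : ℝ} (hb : 1 / 2 ≤ b) (h : Polynomial ℝ) :
    ∃ g : ℝ → ℝ, ContDiff ℝ ∞ g ∧
      ∀ s, 4 * s * deriv (deriv g) s + (4 * b - 2 * s) * deriv g s - a * g s = h.eval s := by
  have hE := kummerCoeff_expBounded a hb 0 h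
  refine ⟨_, hE.contDiff, fun s => ?_⟩
  rw [hE.deriv, hE.derivCoeff.deriv]
  exact kummer_ode a hb 0 h s

lemma kummer_homogeneous (a : ℝ) {b : ℝ} (hb : 1 / 2 ≤ b) (s : ℝ) :
    4 * s * deriv (deriv (kummer a b)) s + (4 * b - 2 * s) * deriv (kummer a b) s
      - a * kummer a b s = 0 := by
  have hE := kummerCoeff_expBounded a hb 1 0
  have := kummer_ode a hb 1 0 s
  rw [← hE.derivCoeff.deriv, ← hE.deriv, Polynomial.eval_zero] at this
  exact this

lemma continuous_kummerCoeff (b : ℝ) (j : ℕ) : Continuous fun a => kummerCoeff a b 1 0 j := by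
  induction j with
  | zero => exact continuous_const
  | succ j ih => simp only [kummerCoeff_succ]; fun_prop

/-- Weierstrass M-test on a box around the given point. -/
lemma continuous_kummer {b : ℝ} (hb : 1 / 2 ≤ b) :
    Continuous fun p : ℝ × ℝ => kummer p.1 b p.2 := by
  refine continuous_iff_continuousAt.2 fun p => ?_
  obtain ⟨A, hA⟩ : ∃ A, A = |p.1| + 1 := ⟨_, rfl⟩
  obtain ⟨B, hB⟩ : ∃ B, B = |p.2| + 1 := ⟨_, rfl⟩
  have hA0 : 0 < A := by rw [hA]; positivity
  have hB0 : 0 < B := by rw [hB]; positivity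
  have hbd : ∀ (j : ℕ) (q : ℝ × ℝ), q ∈ ball (0 : ℝ) A ×ˢ ball (0 : ℝ) B →
      ‖kummerCoeff q.1 b 1 0 j * q.2 ^ j‖ ≤ ((A + 1) * B) ^ j / (j.factorial : ℝ) := by
    intro j q hq
    have h1 : |q.1| ≤ A := by simpa using (mem_ball_zero_iff.1 hq.1).le
    have h2 : |q.2| ≤ B := by simpa using (mem_ball_zero_iff.1 hq.2).le
    rw [norm_mul, norm_pow, Real.norm_eq_abs, Real.norm_eq_abs, mul_pow, mul_div_right_comm]
    refine mul_le_mul ((kummerCoeff_hom_bound q.1 hb j).trans ?_)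
      (pow_le_pow_left₀ (abs_nonneg _) h2 j) (by positivity) (by positivity)
    gcongr
  have hc := continuousOn_tsum
    (fun j => (((continuous_kummerCoeff b j).comp continuous_fst).mul
        (continuous_snd.pow j)).continuousOn)
    (Real.summable_pow_div_factorial ((A + 1) * B)) hbd
  refine hc.continuousAt (IsOpen.mem_nhds (isOpen_ball.prod isOpen_ball) ⟨?_, ?_⟩)
  · simp [hA]
  · simp [hB]

/-- All coefficients are nonnegative and the constant term is `1`. -/
lemma one_le_kummer {a b : ℝ} (ha : 0 ≤ a) (hb : 1 / 2 ≤ b) {s : ℝ} (hs : 0 ≤ s) :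
    1 ≤ kummer a b s := by
  have hc : ∀ j, 0 ≤ kummerCoeff a b 1 0 j := by
    intro j
    induction j with
    | zero => simp [kummerCoeff_zero]
    | succ j ih =>
      rw [kummerCoeff_succ, Polynomial.coeff_zero, add_zero]
      have : 0 ≤ b := by linarith
      positivity
  have h := ((kummerCoeff_expBounded a hb 1 0).summable s).le_tsum 0
    (fun j _ => mul_nonneg (hc j) (pow_nonneg hs j))
  simpa [kummerCoeff_zero, kummer, powerSum] using h

open Filter Topology

/-! ### Elementary facts on the sign of functions of one variable -/

/-- A strict second order test: `h' (r₀) = 0` and `h'' (r₀) < 0` force `h < h r₀` on the left. -/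
lemma exists_lt_left_of_second_deriv_neg {h h' : ℝ → ℝ} {r₀ d : ℝ}
    (hh : ∀ r, HasDerivAt h (h' r) r) (hh' : HasDerivAt h' d r₀) (h0 : h' r₀ = 0) (hd : d < 0) :
    ∃ ε > 0, ∀ r ∈ Ioo (r₀ - ε) r₀, h r < h r₀ := by
  have h1 : ∀ᶠ r in 𝓝[≠] r₀, slope h' r₀ r < 0 := hh'.tendsto_slope.eventually_lt_const hd
  rw [eventually_nhdsWithin_iff, Metric.eventually_nhds_iff] at h1
  obtain ⟨ε, hε, h1⟩ := h1
  refine ⟨ε, hε, fun r hr => ?_⟩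
  have hpos : ∀ x ∈ Ioo r r₀, 0 < h' x := by
    intro x hx
    have h2 : slope h' r₀ x < 0 := by
      refine h1 ?_ (by simpa using hx.2.ne)
      rw [Real.dist_eq, abs_sub_lt_iff]; constructor <;> linarith [hx.1, hx.2, hr.1]
    rw [slope_def_field, h0, sub_zero] at h2
    by_contra hcon
    exact absurd h2 (not_lt.2 (div_nonneg_of_nonpos (not_lt.1 hcon) (by linarith [hx.2])))
  have hmono : StrictMonoOn h (Icc r r₀) := by
    refine strictMonoOn_of_deriv_pos (convex_Icc _ _)
      (fun x _ => (hh x).continuousAt.continuousWithinAt) fun x hx => ?_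
    rw [interior_Icc] at hx
    rw [(hh x).deriv]; exact hpos x hx
  exact hmono ⟨le_rfl, hr.2.le⟩ ⟨hr.2.le, le_rfl⟩ hr.2

/-- At a zero of a function that is nonnegative on `[0, R]`, `h' = 0` excludes `h'' < 0`. -/
lemma second_deriv_nonneg_of_min {h h' : ℝ → ℝ} {R r₀ d : ℝ}
    (hh : ∀ r, HasDerivAt h (h' r) r) (hh' : HasDerivAt h' d r₀) (h0 : h' r₀ = 0)
    (hr : r₀ ∈ Ioc 0 R) (hz : h r₀ = 0) (hn : ∀ r ∈ Icc 0 R, 0 ≤ h r) : 0 ≤ d := by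
  by_contra hd
  obtain ⟨ε, hε, hlt⟩ := exists_lt_left_of_second_deriv_neg hh hh' h0 (not_le.1 hd)
  have hmax : max (r₀ - ε) 0 < r₀ := max_lt (by linarith) hr.1
  obtain ⟨r, h1, h2⟩ := exists_between hmax
  have := hlt r ⟨(le_max_left _ _).trans_lt h1, h2⟩
  have := hn r ⟨((le_max_right _ _).trans_lt h1).le, h2.le.trans hr.2⟩
  linarith

lemma deriv_eq_zero_of_min {h h' : ℝ → ℝ} {R r₀ : ℝ} (hh : ∀ r, HasDerivAt h (h' r) r)
    (hr : r₀ ∈ Ioo 0 R) (hz : h r₀ = 0) (hn : ∀ r ∈ Icc 0 R, 0 ≤ h r) : h' r₀ = 0 := by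
  have : IsLocalMin h r₀ := by
    filter_upwards [Icc_mem_nhds hr.1 hr.2] with r hr'
    rw [hz]; exact hn r hr'
  exact this.hasDerivAt_eq_zero (hh r₀)

/-- Projection along the compact interval is a closed map; hence a first bad parameter is attained.
-/
lemma isClosed_exists_zero {Φ : ℝ → ℝ → ℝ} (hΦ : Continuous fun p : ℝ × ℝ => Φ p.1 p.2) (S : ℝ) :
    IsClosed {μ | ∃ s ∈ Icc 0 S, Φ μ s = 0} := by
  have h1 : IsClosed {p : ℝ × Icc (0 : ℝ) S | Φ p.1 p.2 = 0} :=
    isClosed_eq (hΦ.comp (continuous_fst.prodMk (continuous_subtype_val.comp continuous_snd)))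
      continuous_const
  have h2 := isClosedMap_fst_of_compactSpace (X := ℝ) (Y := Icc (0 : ℝ) S) _ h1
  convert h2 using 1
  ext μ
  simp

lemma pos_of_no_zero {f : ℝ → ℝ} {S : ℝ} (hf : Continuous f) (h0 : 0 < f 0)
    (h : ∀ s ∈ Icc 0 S, f s ≠ 0) : ∀ s ∈ Icc 0 S, 0 < f s := by
  intro s hs
  by_contra hcon
  obtain ⟨t, ht, ht0⟩ := intermediate_value_Icc' hs.1 hf.continuousOn ⟨not_lt.1 hcon, h0.le⟩
  exact h t ⟨ht.1, ht.2.trans hs.2⟩ ht0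

/-- The first parameter for which a continuous family of functions ceases to be positive. -/
lemma exists_first_zero_parameter {Φ : ℝ → ℝ → ℝ} {S m : ℝ}
    (hΦ : Continuous fun p : ℝ × ℝ => Φ p.1 p.2) (h0 : ∀ μ, 0 < Φ μ 0)
    (hpos : ∀ μ ≤ m, ∀ s ∈ Icc 0 S, 0 < Φ μ s) (hex : ∃ μ, ∃ s ∈ Icc 0 S, Φ μ s = 0) :
    ∃ ν, m < ν ∧ (∃ s ∈ Icc 0 S, Φ ν s = 0) ∧ (∀ μ < ν, ∀ s ∈ Icc 0 S, 0 < Φ μ s) ∧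
      ∀ s ∈ Icc 0 S, 0 ≤ Φ ν s := by
  set A := {μ | ∃ s ∈ Icc 0 S, Φ μ s = 0} with hA
  have hlow : ∀ μ ∈ A, m < μ := by
    rintro μ ⟨s, hs, h⟩
    by_contra hcon
    exact (hpos μ (not_lt.1 hcon) s hs).ne' h
  have hbdd : BddBelow A := ⟨m, fun μ hμ => (hlow μ hμ).le⟩
  have hmem : sInf A ∈ A := (isClosed_exists_zero hΦ S).csInf_mem hex hbdd
  have hlt : ∀ μ < sInf A, ∀ s ∈ Icc 0 S, 0 < Φ μ s := by
    intro μ hμ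
    refine pos_of_no_zero (hΦ.comp (continuous_const.prodMk continuous_id)) (h0 μ) fun s hs h => ?_
    exact (csInf_le hbdd (show μ ∈ A from ⟨s, hs, h⟩)).not_gt hμ
  refine ⟨sInf A, hlow _ hmem, hmem, hlt, fun s hs => ?_⟩
  have hc : Continuous fun μ => Φ μ s := hΦ.comp (continuous_id.prodMk continuous_const)
  refine ge_of_tendsto (hc.continuousAt.tendsto.mono_left nhdsWithin_le_nhds :
    Tendsto (fun μ => Φ μ s) (𝓝[<] (sInf A)) _) ?_
  filter_upwards [self_mem_nhdsWithin] with μ hμ using (hlt μ hμ s hs).le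

/-! ### Radial profiles -/

/-- The Neumann expression `r ∂_r` applied to `r ^ k g (r ^ 2)`, divided by `r ^ k`, at `s = r ^ 2`. -/
noncomputable def neumannTrace (k : ℕ) (g : ℝ → ℝ) (s : ℝ) : ℝ := 2 * s * deriv g s + k * g s

/-- The regular solution of the radial equation of angular mode `k`, as a function of `s = r ^ 2`. -/
noncomputable def profile (N k : ℕ) (μ : ℝ) : ℝ → ℝ := kummer (k - μ) (N / 2 + k)

lemma half_le_add {N : ℕ} (hN : 1 ≤ N) (k : ℕ) : (1 : ℝ) / 2 ≤ N / 2 + k := by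
  have h1 : (1 : ℝ) ≤ N := by exact_mod_cast hN
  have h2 : (0 : ℝ) ≤ k := k.cast_nonneg
  linarith

lemma profile_zero (N k : ℕ) (μ : ℝ) : profile N k μ 0 = 1 := kummer_zero _ _

lemma contDiff_profile {N : ℕ} (hN : 1 ≤ N) (k : ℕ) (μ : ℝ) : ContDiff ℝ ∞ (profile N k μ) :=
  contDiff_kummer _ (half_le_add hN k)

lemma profile_ode {N : ℕ} (hN : 1 ≤ N) (k : ℕ) (μ s : ℝ) :
    4 * s * deriv (deriv (profile N k μ)) s
      + (4 * (N / 2 + k) - 2 * s) * deriv (profile N k μ) s - (k - μ) * profile N k μ s = 0 :=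
  kummer_homogeneous _ (half_le_add hN k) s

lemma contDiff_deriv {g : ℝ → ℝ} (hg : ContDiff ℝ ∞ g) : ContDiff ℝ ∞ (deriv g) :=
  (contDiff_infty_iff_deriv.1 hg).2

lemma hasDerivAt_of_contDiff {g : ℝ → ℝ} (hg : ContDiff ℝ ∞ g) (s : ℝ) :
    HasDerivAt g (deriv g s) s :=
  (hg.differentiable (by simp) s).hasDerivAt

lemma continuous_neumannTrace {g : ℝ → ℝ} (hg : ContDiff ℝ ∞ g) (k : ℕ) :
    Continuous (neumannTrace k g) := by
  have h1 := hg.continuous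
  have h2 := (contDiff_deriv hg).continuous
  unfold neumannTrace; fun_prop

/-- This turns the radial Neumann condition at `μ ≠ 0` into the Dirichlet condition of mode one at
`μ - 1`. -/
lemma deriv_profile_zero_mode {N : ℕ} (hN : 1 ≤ N) (μ s : ℝ) :
    deriv (profile N 0 μ) s = -μ / (2 * N) * profile N 1 (μ - 1) s := by
  rw [profile, deriv_kummer _ (half_le_add hN 0), profile]
  have h1 : ((0 : ℕ) : ℝ) - μ + 2 = (1 : ℕ) - (μ - 1) := by push_cast; ring
  have h2 : (N : ℝ) / 2 + (0 : ℕ) + 1 = N / 2 + (1 : ℕ) := by push_cast; ring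
  have h3 : (((0 : ℕ) : ℝ) - μ) / (4 * (N / 2 + (0 : ℕ))) = -μ / (2 * N) := by
    push_cast; congr 1 <;> ring
  rw [h1, h2, h3]

lemma continuous_profile {N : ℕ} (hN : 1 ≤ N) (k : ℕ) :
    Continuous fun p : ℝ × ℝ => profile N k p.1 p.2 :=
  (continuous_kummer (half_le_add hN k)).comp
    ((continuous_const.sub continuous_fst).prodMk continuous_snd)

lemma neumannTrace_profile {N : ℕ} (hN : 1 ≤ N) (k : ℕ) (μ s : ℝ) :
    neumannTrace k (profile N k μ) s = 2 * s * ((k - μ) / (4 * (N / 2 + k)) *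
      kummer (k - μ + 2) (N / 2 + k + 1) s) + k * profile N k μ s := by
  rw [neumannTrace, profile, deriv_kummer _ (half_le_add hN k)]

lemma continuous_neumannTrace_profile {N : ℕ} (hN : 1 ≤ N) (k : ℕ) :
    Continuous fun p : ℝ × ℝ => neumannTrace k (profile N k p.1) p.2 := by
  have h1 := continuous_profile hN k
  have hb : (1 : ℝ) / 2 ≤ N / 2 + k + 1 := by linarith [half_le_add hN k]
  have h2 : Continuous fun p : ℝ × ℝ => kummer (k - p.1 + 2) (N / 2 + k + 1) p.2 :=
    (continuous_kummer hb).comp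
      (((continuous_const.sub continuous_fst).add continuous_const).prodMk continuous_snd)
  simp only [neumannTrace_profile hN]
  fun_prop

lemma profile_pos_of_le {N : ℕ} (hN : 1 ≤ N) {k : ℕ} {μ s : ℝ} (hμ : μ ≤ k) (hs : 0 ≤ s) :
    0 < profile N k μ s :=
  one_pos.trans_le (one_le_kummer (by linarith) (half_le_add hN k) hs)

lemma neumannTrace_profile_pos_of_le {N : ℕ} (hN : 1 ≤ N) {k : ℕ} (hk : 1 ≤ k) {μ s : ℝ}
    (hμ : μ ≤ k) (hs : 0 ≤ s) : 0 < neumannTrace k (profile N k μ) s := by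
  rw [neumannTrace_profile hN]
  have h1 := profile_pos_of_le hN hμ hs
  have hb := half_le_add hN k
  have h2 := one_le_kummer (a := k - μ + 2) (b := N / 2 + k + 1) (by linarith) (by linarith) hs
  have hk' : (0 : ℝ) < k := by exact_mod_cast hk
  have h3 : 0 ≤ (k - μ) / (4 * ((N : ℝ) / 2 + k)) := div_nonneg (by linarith) (by linarith)
  have h4 : 0 ≤ 2 * s * ((k - μ) / (4 * ((N : ℝ) / 2 + k)) * kummer (k - μ + 2) (N / 2 + k + 1) s) :=
    mul_nonneg (by linarith) (mul_nonneg h3 (by linarith))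
  linarith [mul_pos hk' h1]

/-- Maximum principle against the strict subsolution `(S - s) ^ 2`: for large `μ` the profile
vanishes somewhere in `[0, S]`. -/
lemma exists_profile_eq_zero {N : ℕ} (hN : 1 ≤ N) (k : ℕ) {S : ℝ} (hS : 0 < S) :
    ∃ μ, ∃ s ∈ Icc 0 S, profile N k μ s = 0 := by
  by_contra! hcon
  set b : ℝ := N / 2 + k with hb
  have hb0 : (1 : ℝ) / 2 ≤ b := half_le_add hN k
  -- Applied to `(S - s) ^ 2`, with `t = S - s`, the operator at parameter `k + A` gives `8 S - 8 (1
  -- + b) t + A t ^ 2 + 4 s t`. The quadratic in `t` is positive once `A > 2 (1 + b) ^ 2 / S`.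
  set A : ℝ := 2 * (1 + b) ^ 2 / S + 1 with hA
  have hAS : A * S = 2 * (1 + b) ^ 2 + S := by rw [hA]; field_simp
  have hA0 : 0 < A := by rw [hA]; positivity
  set g := profile N k (k + A) with hg
  have hgs : ContDiff ℝ ∞ g := contDiff_profile hN k _
  have hg0 : g 0 = 1 := profile_zero _ _ _
  have hpos : ∀ s ∈ Icc 0 S, 0 < g s :=
    pos_of_no_zero hgs.continuous (by rw [hg0]; exact one_pos) (hcon _)
  have hode := profile_ode hN k (k + A)
  rw [← hg, ← hb] at hode
  have hne : (Icc 0 S).Nonempty := ⟨0, le_rfl, hS.le⟩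
  obtain ⟨s₀, hs₀, hmax⟩ := isCompact_Icc.exists_isMaxOn hne
    (f := fun s => (S - s) ^ 2 / g s)
    (ContinuousOn.div (by fun_prop) hgs.continuous.continuousOn fun s hs => (hpos s hs).ne')
  -- With this `m`, the function `m g - (S - s) ^ 2` is nonnegative and touches zero at `s₀`, while
  -- the operator applied to it is negative there.
  set m := (S - s₀) ^ 2 / g s₀ with hm
  have hle : ∀ s ∈ Icc 0 S, 0 ≤ m * g s - (S - s) ^ 2 := by
    intro s hs
    have h1 : (S - s) ^ 2 / g s ≤ m := hmax hs
    rw [div_le_iff₀ (hpos s hs)] at h1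
    linarith
  have hz : m * g s₀ - (S - s₀) ^ 2 = 0 := by
    rw [hm, div_mul_cancel₀ _ (hpos s₀ hs₀).ne', sub_self]
  have hm0 : 0 < m := by
    have h1 := hle 0 ⟨le_rfl, hS.le⟩
    rw [hg0] at h1; nlinarith [pow_pos hS 2]
  have hlt : s₀ < S := by
    refine lt_of_le_of_ne hs₀.2 fun h => ?_
    rw [h] at hz
    have := mul_pos hm0 (hpos S ⟨hS.le, le_rfl⟩)
    simp at hz; rcases hz with hz | hz <;> simp [hz] at this
  have hd : ∀ s, HasDerivAt (fun s => m * g s - (S - s) ^ 2) (m * deriv g s + 2 * (S - s)) s := by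
    intro s
    have h1 := ((hasDerivAt_of_contDiff hgs s).const_mul m).sub
      (((hasDerivAt_id s).const_sub S).pow 2)
    refine h1.congr_deriv ?_
    simp
  have hd2 : HasDerivAt (fun s => m * deriv g s + 2 * (S - s)) (m * deriv (deriv g) s₀ - 2) s₀ := by
    have h1 := ((hasDerivAt_of_contDiff (contDiff_deriv hgs) s₀).const_mul m).add
      (((hasDerivAt_id s₀).const_sub S).const_mul 2)
    refine h1.congr_deriv ?_
    ring
  have hode0 := hode s₀
  have hsub : 0 < 8 * S - 8 * (1 + b) * (S - s₀) + A * (S - s₀) ^ 2 := by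
    have h1 : S * (8 * S - 8 * (1 + b) * (S - s₀) + A * (S - s₀) ^ 2) =
        8 * S ^ 2 - 8 * (1 + b) * S * (S - s₀) + (2 * (1 + b) ^ 2 + S) * (S - s₀) ^ 2 := by
      rw [← hAS]; ring
    have h2 : 0 < S * (8 * S - 8 * (1 + b) * (S - s₀) + A * (S - s₀) ^ 2) := by
      rw [h1]
      nlinarith [sq_nonneg (2 * S - (1 + b) * (S - s₀)), mul_pos hS (pow_pos (sub_pos.2 hlt) 2)]
    exact pos_of_mul_pos_right h2 hS.le
  have hop : 4 * s₀ * (m * deriv (deriv g) s₀ - 2)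
      + (4 * b - 2 * s₀) * (m * deriv g s₀ + 2 * (S - s₀)) < 0 := by
    have h1 : 0 ≤ 4 * s₀ * (S - s₀) := mul_nonneg (by linarith [hs₀.1]) (by linarith)
    have h2 : 4 * s₀ * (m * deriv (deriv g) s₀ - 2)
      + (4 * b - 2 * s₀) * (m * deriv g s₀ + 2 * (S - s₀)) = 
      m * (4 * s₀ * deriv (deriv g) s₀ + (4 * b - 2 * s₀) * deriv g s₀ - (k - (k + A)) * g s₀)
      - A * (m * g s₀ - (S - s₀) ^ 2)
      - (8 * S - 8 * (1 + b) * (S - s₀) + A * (S - s₀) ^ 2) - 4 * s₀ * (S - s₀) := by ring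
    rw [h2, hode0, hz]; linarith
  -- At `s₀ = 0` the second order term drops out and the one-sided sign of the first derivative
  -- suffices.
  rcases eq_or_lt_of_le hs₀.1 with h0 | h0
  · rw [← h0] at hop hz
    have h1 : 0 ≤ m * deriv g 0 + 2 * (S - 0) := by
      by_contra hneg
      have := (hd 0).tendsto_slope.eventually_lt_const (not_le.1 hneg)
      have h2 : ∀ᶠ s in 𝓝[>] (0 : ℝ), slope (fun s => m * g s - (S - s) ^ 2) 0 s < 0 :=
        this.filter_mono (nhdsWithin_mono _ fun x hx => ne_of_gt hx)
      have h3 : ∀ᶠ s in 𝓝[>] (0 : ℝ), s ∈ Ioo 0 S := Ioo_mem_nhdsGT hS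
      obtain ⟨s, h2, h3⟩ := (h2.and h3).exists
      rw [slope_def_field, hz, sub_zero, sub_zero] at h2
      exact absurd h2 (not_lt.2 (div_nonneg (hle s ⟨h3.1.le, h3.2.le⟩) h3.1.le))
    nlinarith
  · have h1 := deriv_eq_zero_of_min hd ⟨h0, hlt⟩ hz hle
    have h2 := second_deriv_nonneg_of_min hd hd2 h1 ⟨h0, hs₀.2⟩ hz hle
    rw [h1] at hop
    nlinarith [mul_nonneg h0.le h2]

/-! ### The function `r ^ (l + 1) g (r ^ 2)` -/

lemma hasDerivAt_comp_sq {g : ℝ → ℝ} (hg : ContDiff ℝ ∞ g) (r : ℝ) :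
    HasDerivAt (fun r => g (r ^ 2)) (2 * r * deriv g (r ^ 2)) r := by
  have h := (hasDerivAt_of_contDiff hg (r ^ 2)).comp r (hasDerivAt_pow 2 r)
  refine h.congr_deriv ?_
  simp; ring

lemma hasDerivAt_pow_mul {g : ℝ → ℝ} (hg : ContDiff ℝ ∞ g) (l : ℕ) (r : ℝ) :
    HasDerivAt (fun r => r ^ (l + 1) * g (r ^ 2)) (r ^ l * neumannTrace (l + 1) g (r ^ 2)) r := by
  have h := (hasDerivAt_pow (l + 1) r).mul (hasDerivAt_comp_sq hg r)
  refine h.congr_deriv ?_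
  rw [neumannTrace]; push_cast; ring

/-- The second derivative, when `g` solves the equation of mode `l + 1`. -/
lemma hasDerivAt_second {N : ℕ} {μ : ℝ} {g : ℝ → ℝ} (hg : ContDiff ℝ ∞ g) (l : ℕ)
    (hode : ∀ s, 4 * s * deriv (deriv g) s + (4 * (N / 2 + ((l + 1 : ℕ) : ℝ)) - 2 * s) * deriv g s
      - (((l + 1 : ℕ) : ℝ) - μ) * g s = 0) {r : ℝ} (hr : r ≠ 0) :
    HasDerivAt (fun r => r ^ l * neumannTrace (l + 1) g (r ^ 2))
      (-((N - 1) / r - r) * (r ^ l * neumannTrace (l + 1) g (r ^ 2))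
        - (μ - (l + 1) * (l + N - 1) / r ^ 2) * (r ^ (l + 1) * g (r ^ 2))) r := by
  have h1 := hasDerivAt_comp_sq hg r
  have h2 := hasDerivAt_comp_sq (contDiff_deriv hg) r
  have h3 : HasDerivAt (fun r => neumannTrace (l + 1) g (r ^ 2))
      (4 * r * deriv g (r ^ 2) + 2 * r ^ 2 * (2 * r * deriv (deriv g) (r ^ 2))
        + (l + 1) * (2 * r * deriv g (r ^ 2))) r := by
    have h4 := ((((hasDerivAt_pow 2 r).const_mul 2).mul h2).add
      (h1.const_mul (((l + 1 : ℕ) : ℝ))))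
    refine h4.congr_deriv ?_
    rw [show (2 - 1 : ℕ) = 1 from rfl, pow_one]; push_cast; ring
  have h5 := (hasDerivAt_pow l r).mul h3
  refine h5.congr_deriv ?_
  have e := hode (r ^ 2)
  -- For `l = 0` the truncated exponent is harmless because of the factor `l`.
  have e2 : (l : ℝ) * r ^ (l - 1) * r = l * r ^ l := by
    rcases l with _ | l
    · simp
    · simp [pow_succ]; ring
  have e3 : (l : ℝ) * r ^ (l - 1) = l * r ^ l / r := by rw [← e2]; field_simp
  rw [e3, neumannTrace]
  push_cast at e ⊢
  field_simp
  linear_combination (r ^ l * r ^ 3) * e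

/-- If `r g (r ^ 2)` is nondecreasing on `[0, R]`, then `g > 0`. -/
lemma monotone_and_pos {g : ℝ → ℝ} (hg : ContDiff ℝ ∞ g) (h0 : 0 < g 0) {R : ℝ}
    (hF : ∀ r ∈ Icc 0 R, 0 ≤ neumannTrace 1 g (r ^ 2)) :
    MonotoneOn (fun r => r * g (r ^ 2)) (Icc 0 R) ∧ ∀ r ∈ Icc 0 R, 0 < g (r ^ 2) := by
  have hd : ∀ r, HasDerivAt (fun r => r * g (r ^ 2)) (neumannTrace 1 g (r ^ 2)) r := by
    intro r; simpa using hasDerivAt_pow_mul hg 0 r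
  have hmono : MonotoneOn (fun r => r * g (r ^ 2)) (Icc 0 R) := by
    refine monotoneOn_of_deriv_nonneg (convex_Icc _ _)
      (fun x _ => (hd x).continuousAt.continuousWithinAt)
      (fun x _ => (hd x).differentiableAt.differentiableWithinAt) fun x hx => ?_
    rw [(hd x).deriv]; exact hF x (interior_subset hx)
  refine ⟨hmono, fun r hr => ?_⟩
  rcases eq_or_lt_of_le hr.1 with h | h
  · rw [← h]; simpa using h0
  · have hc : Continuous fun r : ℝ => g (r ^ 2) := hg.continuous.comp (continuous_pow 2)
    -- Positivity near the origin is carried outwards by the monotonicity of `r g(r ^ 2)`.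
    have h1 : ∀ᶠ t in 𝓝[>] (0 : ℝ), 0 < g (t ^ 2) :=
      nhdsWithin_le_nhds (hc.continuousAt.eventually (lt_mem_nhds (by simpa using h0)))
    have h2 : ∀ᶠ t in 𝓝[>] (0 : ℝ), t ∈ Ioo 0 r := Ioo_mem_nhdsGT h
    obtain ⟨t, h1, h2⟩ := (h1.and h2).exists
    have h3 : t * g (t ^ 2) ≤ r * g (r ^ 2) :=
      hmono ⟨h2.1.le, h2.2.le.trans hr.2⟩ hr h2.2.le
    exact pos_of_mul_pos_right ((mul_pos h2.1 h1).trans_le h3) h.le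

/-! ### Critical parameters: Neumann and Dirichlet conditions in mode one, and comparison of modes.
-/

lemma exists_sq_eq {R s : ℝ} (hR : 0 < R) (hs : s ∈ Icc 0 (R ^ 2)) :
    ∃ r ∈ Icc 0 R, r ^ 2 = s :=
  ⟨√s, ⟨Real.sqrt_nonneg _, Real.sqrt_le_iff.2 ⟨hR.le, hs.2⟩⟩, Real.sq_sqrt hs.1⟩

lemma sq_mem_Icc {R r : ℝ} (hr : r ∈ Icc 0 R) : r ^ 2 ∈ Icc 0 (R ^ 2) :=
  ⟨sq_nonneg _, pow_le_pow_left₀ hr.1 hr.2 2⟩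

/-- The lowest Neumann parameter of mode one. -/
lemma exists_mode_one_neumann {N : ℕ} (hN : 1 ≤ N) {R : ℝ} (hR : 0 < R) :
    ∃ ν, 1 < ν ∧ (∀ s ∈ Icc 0 (R ^ 2), 0 < profile N 1 ν s) ∧
      (∀ s ∈ Icc 0 (R ^ 2), 0 ≤ neumannTrace 1 (profile N 1 ν) s) ∧
      neumannTrace 1 (profile N 1 ν) (R ^ 2) = 0 ∧
      ∀ μ < ν, ∀ s ∈ Icc 0 (R ^ 2), 0 < neumannTrace 1 (profile N 1 μ) s := by
  have hS : 0 < R ^ 2 := by positivity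
  have htr0 : ∀ μ, neumannTrace 1 (profile N 1 μ) 0 = 1 := fun μ => by
    simp [neumannTrace, profile_zero]
  -- If the trace never vanished it would be positive, so the profile would be positive for every
  -- `μ`, contrary to `exists_profile_eq_zero`.
  have hex : ∃ μ, ∃ s ∈ Icc 0 (R ^ 2), neumannTrace 1 (profile N 1 μ) s = 0 := by
    obtain ⟨μ, s, hs, hz⟩ := exists_profile_eq_zero hN 1 hS
    refine ⟨μ, ?_⟩
    by_contra! hcon
    have h1 := pos_of_no_zero (continuous_neumannTrace (contDiff_profile hN 1 μ) 1)
      (by rw [htr0]; exact one_pos) hcon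
    obtain ⟨r, hr, rfl⟩ := exists_sq_eq hR hs
    exact ((monotone_and_pos (contDiff_profile hN 1 μ) (by rw [profile_zero]; exact one_pos)
      (fun r hr => (h1 _ (sq_mem_Icc hr)).le)).2 r hr).ne' hz
  obtain ⟨ν, hν, ⟨s₀, hs₀, hz⟩, hlt, hnn⟩ := exists_first_zero_parameter (m := 1)
    (continuous_neumannTrace_profile hN 1) (fun μ => by rw [htr0]; exact one_pos)
    (fun μ hμ s hs => neumannTrace_profile_pos_of_le hN le_rfl (by simpa using hμ) hs.1) hex
  set g := profile N 1 ν with hg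
  have hgs : ContDiff ℝ ∞ g := contDiff_profile hN 1 ν
  have hgpos : ∀ s ∈ Icc 0 (R ^ 2), 0 < g s := by
    intro s hs
    obtain ⟨r, hr, rfl⟩ := exists_sq_eq hR hs
    exact (monotone_and_pos hgs (by rw [hg, profile_zero]; exact one_pos)
      (fun r hr => hnn _ (sq_mem_Icc hr))).2 r hr
  refine ⟨ν, hν, hgpos, hnn, ?_, hlt⟩
  have hs₀pos : 0 < s₀ := by
    refine lt_of_le_of_ne hs₀.1 fun h => ?_
    rw [← h, htr0] at hz
    exact one_ne_zero hz
  rcases eq_or_lt_of_le hs₀.2 with h | h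
  · rwa [← h]
  -- Suppose the trace `T = 2 s g' + g` touches zero at an interior `s₀`. Then `g = -2 s₀ g'`, so
  -- `g' < 0`; the equation and `T' = 0` give `s₀ - 2 b + 3 = (1 - ν) s₀`, and hence `T'' = ν g' <
  -- 0`, which a minimum forbids.
  exfalso
  have hode := profile_ode hN 1 ν
  rw [← hg] at hode
  set b : ℝ := N / 2 + (1 : ℕ) with hb
  have h1 := hasDerivAt_of_contDiff hgs
  have h2 := hasDerivAt_of_contDiff (contDiff_deriv hgs)
  have hd : ∀ s, HasDerivAt (neumannTrace 1 g)
      ((s - 2 * b + 3) * deriv g s + (1 - ν) / 2 * g s) s := by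
    intro s
    have h3 := (((hasDerivAt_id s).const_mul 2).mul (h2 s)).add ((h1 s).const_mul ((1 : ℕ) : ℝ))
    refine h3.congr_deriv ?_
    have e := hode s
    push_cast at e ⊢
    simp only [id]
    linear_combination (1 / 2) * e
  have hd2 : HasDerivAt (fun s => (s - 2 * b + 3) * deriv g s + (1 - ν) / 2 * g s)
      (deriv g s₀ + (s₀ - 2 * b + 3) * deriv (deriv g) s₀ + (1 - ν) / 2 * deriv g s₀) s₀ := by
    have h3 := (((((hasDerivAt_id s₀).sub_const (2 * b)).add_const 3).mul (h2 s₀))).add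
      ((h1 s₀).const_mul ((1 - ν) / 2))
    refine h3.congr_deriv ?_
    simp
  have e0 := deriv_eq_zero_of_min hd ⟨hs₀pos, h⟩ hz hnn
  have e1 := second_deriv_nonneg_of_min hd hd2 e0 ⟨hs₀pos, hs₀.2⟩ hz hnn
  have e2 := hode s₀
  have e3 : g s₀ = -2 * s₀ * deriv g s₀ := by
    rw [neumannTrace] at hz; push_cast at hz; linarith
  have hgp := hgpos s₀ hs₀
  have hg' : deriv g s₀ < 0 := by
    by_contra hcon
    nlinarith [mul_nonneg hs₀pos.le (not_lt.1 hcon)]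
  have e4 : s₀ - 2 * b + 3 = (1 - ν) * s₀ := by
    rw [e3] at e0
    have : deriv g s₀ * (s₀ - 2 * b + 3 - (1 - ν) * s₀) = 0 := by linear_combination e0
    rcases mul_eq_zero.1 this with h5 | h5
    · exact absurd h5 hg'.ne
    · linarith
  have e5 : deriv g s₀ + (s₀ - 2 * b + 3) * deriv (deriv g) s₀ + (1 - ν) / 2 * deriv g s₀
      = ν * deriv g s₀ := by
    rw [e4]
    rw [e3] at e2
    push_cast at e2
    linear_combination ((1 - ν) / 4) * e2 + (1 - ν) / 2 * deriv g s₀ * e4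
  rw [e5] at e1
  nlinarith

/-- The lowest Dirichlet parameter of mode one. -/
lemma exists_mode_one_dirichlet {N : ℕ} (hN : 1 ≤ N) {S : ℝ} (hS : 0 < S) :
    ∃ l, 1 < l ∧ profile N 1 l S = 0 ∧ ∀ μ < l, ∀ s ∈ Icc 0 S, 0 < profile N 1 μ s := by
  obtain ⟨l, hl, ⟨s₀, hs₀, hz⟩, hlt, hnn⟩ := exists_first_zero_parameter (m := 1)
    (continuous_profile hN 1) (fun μ => by rw [profile_zero]; exact one_pos)
    (fun μ hμ s hs => profile_pos_of_le hN (by simpa using hμ) hs.1)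
    (exists_profile_eq_zero hN 1 hS)
  refine ⟨l, hl, ?_, hlt⟩
  rcases eq_or_lt_of_le hs₀.2 with h | h
  · rwa [← h]
  exfalso
  have hs₀pos : 0 < s₀ := by
    refine lt_of_le_of_ne hs₀.1 fun h => ?_
    rw [← h, profile_zero] at hz
    exact one_ne_zero hz
  set g := profile N 1 l with hg
  have hgs : ContDiff ℝ ∞ g := contDiff_profile hN 1 l
  have hode := profile_ode hN 1 l
  rw [← hg] at hode
  set b : ℝ := N / 2 + (1 : ℕ) with hb
  have hb0 : 0 < b := by rw [hb]; positivity
  have e0 := deriv_eq_zero_of_min (hasDerivAt_of_contDiff hgs) ⟨hs₀pos, h⟩ hz hnn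
  -- This is the flux of the Sturm–Liouville form. It is nonincreasing because `l > 1` and `g ≥ 0`,
  -- and it vanishes at `0` and at an interior double zero `s₀`. So `g' = 0` on `(0, s₀)`, hence at
  -- `0`, where the equation forces `4 b g' 0 = 1 - l ≠ 0`.
  set q : ℝ → ℝ := fun s => s ^ b * Real.exp (-s / 2) * deriv g s with hq
  have hqc : Continuous q := by
    have h1 := (contDiff_deriv hgs).continuous
    have h2 : Continuous fun s : ℝ => s ^ b := Real.continuous_rpow_const hb0.le
    rw [hq]; fun_prop
  have hqd : ∀ s, 0 < s → HasDerivAt q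
      (s ^ b * Real.exp (-s / 2) * ((1 - l) * g s) / (4 * s)) s := by
    intro s hs
    have h1 := Real.hasDerivAt_rpow_const (x := s) (p := b) (Or.inl hs.ne')
    have h2 : HasDerivAt (fun s : ℝ => Real.exp (-s / 2)) (Real.exp (-s / 2) * (-1 / 2)) s :=
      (((hasDerivAt_id s).neg).div_const 2).exp
    have h3 := (h1.mul h2).mul (hasDerivAt_of_contDiff (contDiff_deriv hgs) s)
    refine h3.congr_deriv ?_
    have e := hode s
    push_cast at e
    have e' : (1 - l) * g s = 4 * s * deriv (deriv g) s + (4 * b - 2 * s) * deriv g s := by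
      linarith
    rw [e', Real.rpow_sub_one hs.ne']
    simp only [Pi.mul_apply]
    field_simp
    ring
  have hanti : AntitoneOn q (Icc 0 s₀) := by
    refine antitoneOn_of_deriv_nonpos (convex_Icc _ _) hqc.continuousOn
      (fun s hs => ?_) fun s hs => ?_
    · rw [interior_Icc] at hs
      exact (hqd s hs.1).differentiableAt.differentiableWithinAt
    · rw [interior_Icc] at hs
      rw [(hqd s hs.1).deriv]
      refine div_nonpos_of_nonpos_of_nonneg ?_ (by linarith [hs.1])
      have h1 := hnn s ⟨hs.1.le, (hs.2.trans h).le⟩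
      have h2 : 0 ≤ s ^ b * Real.exp (-s / 2) :=
        mul_nonneg (Real.rpow_nonneg hs.1.le _) (Real.exp_pos _).le
      exact mul_nonpos_of_nonneg_of_nonpos h2
        (mul_nonpos_of_nonpos_of_nonneg (by linarith) h1)
  have hq0 : q 0 = 0 := by simp [hq, Real.zero_rpow hb0.ne']
  have hqs : q s₀ = 0 := by simp [hq, e0]
  have hg'0 : ∀ s ∈ Ioo 0 s₀, deriv g s = 0 := by
    intro s hs
    have h1 : q s ≤ q 0 := hanti ⟨le_rfl, hs₀pos.le⟩ ⟨hs.1.le, hs.2.le⟩ hs.1.le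
    have h2 : q s₀ ≤ q s := hanti ⟨hs.1.le, hs.2.le⟩ ⟨hs₀pos.le, le_rfl⟩ hs.2.le
    have h3 : q s = 0 := by linarith
    have h4 : 0 < s ^ b * Real.exp (-s / 2) :=
      mul_pos (Real.rpow_pos_of_pos hs.1 _) (Real.exp_pos _)
    exact (mul_eq_zero.1 h3).resolve_left h4.ne'
  have hlim : deriv g 0 = 0 := by
    have h1 : Tendsto (deriv g) (𝓝[>] 0) (𝓝 (deriv g 0)) :=
      (contDiff_deriv hgs).continuous.continuousAt.tendsto.mono_left nhdsWithin_le_nhds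
    refine tendsto_nhds_unique_of_eventuallyEq h1 tendsto_const_nhds ?_
    filter_upwards [Ioo_mem_nhdsGT hs₀pos] with s hs using hg'0 s hs
  have e := hode 0
  rw [hlim, hg, profile_zero] at e
  push_cast at e
  linarith

/-- Sturm comparison with the first function of mode one. -/
lemma neumannTrace_ne_zero_of_two_le {N : ℕ} (hN : 1 ≤ N) {R : ℝ} (hR : 0 < R) {ν μ : ℝ}
    (hpos : ∀ s ∈ Icc 0 (R ^ 2), 0 < profile N 1 ν s)
    (hz : neumannTrace 1 (profile N 1 ν) (R ^ 2) = 0) (hμ : μ ≤ ν) {k : ℕ} (hk : 2 ≤ k) :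
    neumannTrace k (profile N k μ) (R ^ 2) ≠ 0 := by
  intro hzk
  obtain ⟨l, rfl⟩ : ∃ l, k = l + 1 := ⟨k - 1, by omega⟩
  have hl : 1 ≤ l := by omega
  set g := profile N 1 ν with hg
  set f := profile N (l + 1) μ with hf
  have hgs : ContDiff ℝ ∞ g := contDiff_profile hN 1 ν
  have hfs : ContDiff ℝ ∞ f := contDiff_profile hN (l + 1) μ
  -- Maximizing the quotient of the functions of modes `l + 1` and `1` gives the multiple of the
  -- latter that touches the former from above. The maximum is positive although nothing is known on
  -- the sign of `f` away from `0`, and `r₀ > 0` since `l ≥ 1`.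
  obtain ⟨r₀, hr₀, hmax⟩ := isCompact_Icc.exists_isMaxOn (⟨0, le_rfl, hR.le⟩ : (Icc 0 R).Nonempty)
    (f := fun r => r ^ l * f (r ^ 2) / g (r ^ 2))
    (ContinuousOn.div (by have := hfs.continuous; fun_prop)
      (by have := hgs.continuous; fun_prop) fun r hr => (hpos _ (sq_mem_Icc hr)).ne')
  set m := r₀ ^ l * f (r₀ ^ 2) / g (r₀ ^ 2) with hm
  have hm0 : 0 < m := by
    have hc : Continuous fun r : ℝ => f (r ^ 2) := hfs.continuous.comp (continuous_pow 2)
    have h1 : ∀ᶠ t in 𝓝[>] (0 : ℝ), 0 < f (t ^ 2) :=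
      nhdsWithin_le_nhds (hc.continuousAt.eventually
        (lt_mem_nhds (by simp [hf, profile_zero])))
    obtain ⟨t, h1, h2⟩ := (h1.and (Ioo_mem_nhdsGT hR)).exists
    have h3 : t ^ l * f (t ^ 2) / g (t ^ 2) ≤ m := hmax ⟨h2.1.le, h2.2.le⟩
    exact (div_pos (mul_pos (pow_pos h2.1 l) h1)
      (hpos _ (sq_mem_Icc ⟨h2.1.le, h2.2.le⟩))).trans_le h3
  have hr₀pos : 0 < r₀ := by
    refine lt_of_le_of_ne hr₀.1 fun h => ?_
    rw [hm, ← h, zero_pow (by omega)] at hm0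
    simp at hm0
  have hle : ∀ r ∈ Icc 0 R, 0 ≤ m * (r ^ (0 + 1) * g (r ^ 2)) - r ^ (l + 1) * f (r ^ 2) := by
    intro r hr
    have h1 : r ^ l * f (r ^ 2) / g (r ^ 2) ≤ m := hmax hr
    rw [div_le_iff₀ (hpos _ (sq_mem_Icc hr))] at h1
    have h2 := mul_nonneg hr.1 (sub_nonneg.2 h1)
    have h3 : r * (m * g (r ^ 2) - r ^ l * f (r ^ 2))
      = m * (r ^ (0 + 1) * g (r ^ 2)) - r ^ (l + 1) * f (r ^ 2) := by ring
    rwa [h3] at h2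
  have hz0 : m * (r₀ ^ (0 + 1) * g (r₀ ^ 2)) - r₀ ^ (l + 1) * f (r₀ ^ 2) = 0 := by
    have : m * g (r₀ ^ 2) = r₀ ^ l * f (r₀ ^ 2) := by
      rw [hm, div_mul_cancel₀ _ (hpos _ (sq_mem_Icc hr₀)).ne']
    linear_combination r₀ * this
  have hd := fun r => ((hasDerivAt_pow_mul hgs 0 r).const_mul m).sub (hasDerivAt_pow_mul hfs l r)
  have hd2 := ((hasDerivAt_second hgs 0 (profile_ode hN (0 + 1) ν) hr₀pos.ne').const_mul m).sub
    (hasDerivAt_second hfs l (profile_ode hN (l + 1) μ) hr₀pos.ne')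
  -- If the contact point is `R`, the two Neumann conditions replace the interior first order
  -- condition.
  have e0 : m * (r₀ ^ 0 * neumannTrace (0 + 1) g (r₀ ^ 2))
      - r₀ ^ l * neumannTrace (l + 1) f (r₀ ^ 2) = 0 := by
    rcases eq_or_lt_of_le hr₀.2 with h | h
    · rw [h, hzk, zero_add, hz]; simp
    · exact deriv_eq_zero_of_min (r₀ := r₀) hd ⟨hr₀pos, h⟩ hz0 hle
  have e1 := second_deriv_nonneg_of_min hd hd2 e0 ⟨hr₀pos, hr₀.2⟩ hz0 hle
  have hw : 0 < m * (r₀ ^ (0 + 1) * g (r₀ ^ 2)) :=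
    mul_pos hm0 (mul_pos (pow_pos hr₀pos _) (hpos _ (sq_mem_Icc hr₀)))
  set w := m * (r₀ ^ (0 + 1) * g (r₀ ^ 2)) with hwdef
  have hw2 : r₀ ^ (l + 1) * f (r₀ ^ 2) = w := by linarith
  have e2 : m * (-((N - 1) / r₀ - r₀) * (r₀ ^ 0 * neumannTrace (0 + 1) g (r₀ ^ 2))
        - (ν - (((0 : ℕ) : ℝ) + 1) * ((0 : ℕ) + N - 1) / r₀ ^ 2) * (r₀ ^ (0 + 1) * g (r₀ ^ 2)))
      - (-((N - 1) / r₀ - r₀) * (r₀ ^ l * neumannTrace (l + 1) f (r₀ ^ 2))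
        - (μ - ((l : ℝ) + 1) * (l + N - 1) / r₀ ^ 2) * (r₀ ^ (l + 1) * f (r₀ ^ 2)))
      = -((N - 1) / r₀ - r₀) * (m * (r₀ ^ 0 * neumannTrace (0 + 1) g (r₀ ^ 2))
      - r₀ ^ l * neumannTrace (l + 1) f (r₀ ^ 2))
      + w * ((μ - ν) + ((N - 1) - ((l : ℝ) + 1) * (l + N - 1)) / r₀ ^ 2) := by
    rw [hw2, hwdef]; push_cast; ring
  rw [e2, e0, mul_zero, zero_add] at e1
  have hl' : (1 : ℝ) ≤ l := by exact_mod_cast hl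
  have hN' : (1 : ℝ) ≤ N := by exact_mod_cast hN
  -- The angular eigenvalue `k (k + N - 2)` at `k = l + 1 ≥ 2` exceeds its value `N - 1` at `k = 1`.
  have h3 : ((N - 1) - ((l : ℝ) + 1) * (l + N - 1)) / r₀ ^ 2 < 0 :=
    div_neg_of_neg_of_pos (by nlinarith) (by positivity)
  have h4 := mul_neg_of_pos_of_neg hw (show (μ - ν) + ((N - 1) - ((l : ℝ) + 1) * (l + N - 1)) / r₀ ^ 2 < 0 by
    linarith)
  linarith

/-- Where the profiles satisfy the Neumann condition at `r = R`, for parameters below the first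
radial eigenvalue, and below the first eigenvalue of mode one. -/
theorem exists_neumann_parameters {N : ℕ} (hN : 1 ≤ N) {R : ℝ} (hR : 0 < R) :
    ∃ ν τ, 1 < ν ∧ ν < τ ∧ (∀ s ∈ Icc 0 (R ^ 2), 0 < profile N 1 ν s) ∧
      (∀ s ∈ Icc 0 (R ^ 2), 0 ≤ neumannTrace 1 (profile N 1 ν) s) ∧
      neumannTrace 1 (profile N 1 ν) (R ^ 2) = 0 ∧
      neumannTrace 0 (profile N 0 τ) (R ^ 2) = 0 ∧
      (∀ k, 1 ≤ k → ∀ μ < ν, neumannTrace k (profile N k μ) (R ^ 2) ≠ 0) ∧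
      (∀ k, 2 ≤ k → ∀ μ ≤ ν, neumannTrace k (profile N k μ) (R ^ 2) ≠ 0) ∧
      ∀ μ < τ, μ ≠ 0 → neumannTrace 0 (profile N 0 μ) (R ^ 2) ≠ 0 := by
  have hS : 0 < R ^ 2 := by positivity
  have hSmem : R ^ 2 ∈ Icc 0 (R ^ 2) := ⟨hS.le, le_rfl⟩
  obtain ⟨ν, hν, hgpos, hnn, hz, hlt⟩ := exists_mode_one_neumann hN hR
  obtain ⟨l, hl, hlz, hll⟩ := exists_mode_one_dirichlet hN hS
  -- At `ν` the profile is positive at `R ^ 2`; at any smaller parameter the trace is positive,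
  -- hence so is the profile. The Dirichlet parameter `l` is therefore larger.
  have hνl : ν < l := by
    rcases lt_trichotomy ν l with h | h | h
    · exact h
    · exact absurd hlz (h ▸ (hgpos _ hSmem).ne')
    · refine absurd hlz (ne_of_gt ?_)
      exact (monotone_and_pos (contDiff_profile hN 1 l) (by rw [profile_zero]; exact one_pos)
        (fun r hr => (hlt l h _ (sq_mem_Icc hr)).le)).2 R ⟨hR.le, le_rfl⟩
  refine ⟨ν, l + 1, hν, by linarith, hgpos, hnn, hz, ?_, ?_, ?_, ?_⟩
  · rw [neumannTrace, deriv_profile_zero_mode hN, add_sub_cancel_right, hlz]; simp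
  · intro k hk μ hμ
    rcases eq_or_lt_of_le hk with rfl | h
    · exact (hlt μ hμ _ hSmem).ne'
    · exact neumannTrace_ne_zero_of_two_le hN hR hgpos hz hμ.le h
  · exact fun k hk μ hμ => neumannTrace_ne_zero_of_two_le hN hR hgpos hz hμ hk
  · intro μ hμ h0
    rw [neumannTrace, deriv_profile_zero_mode hN]
    have h1 := hll (μ - 1) (by linarith) _ hSmem
    have h2 : (0 : ℝ) < N := by exact_mod_cast hN
    simp [h0, h1.ne', hS.ne', h2.ne']

variable {N : ℕ} {R : ℝ}

/-! ### The Gaussian measure on a ball -/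

lemma gaussDensity_pos (x : E N) : 0 < gaussDensity N x := by
  unfold gaussDensity; positivity

lemma contDiff_gaussDensity : ContDiff ℝ ∞ (gaussDensity N) := by
  have h : ContDiff ℝ ∞ fun x : E N => ‖x‖ ^ 2 := contDiff_norm_sq ℝ
  unfold gaussDensity
  exact contDiff_const.mul (h.neg.div_const 2).exp

lemma hasFDerivAt_norm_sq (x : E N) :
    HasFDerivAt (fun x : E N => ‖x‖ ^ 2) (2 • innerSL ℝ x) x :=
  (hasStrictFDerivAt_norm_sq x).hasFDerivAt

lemma fderiv_gaussDensity (x e : E N) :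
    fderiv ℝ (gaussDensity N) x e = -(inner ℝ x e * gaussDensity N x) := by
  have h : HasFDerivAt (gaussDensity N) _ x :=
    (((hasFDerivAt_norm_sq x).neg.mul_const (1 / 2)).exp).const_mul
      ((2 * Real.pi) ^ (-(N : ℝ) / 2)) |>.congr_of_eventuallyEq
      (Eventually.of_forall fun y => by
        simp only [gaussDensity, div_eq_mul_inv, one_mul, Pi.neg_apply])
  rw [h.fderiv, gaussDensity]
  simp [div_eq_mul_inv]
  ring

lemma measurable_ofReal_gaussDensity :
    Measurable fun x : E N => ENNReal.ofReal (gaussDensity N x) :=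
  contDiff_gaussDensity.continuous.measurable.ennreal_ofReal

lemma gauss_absolutelyContinuous : gauss N ≪ (volume : Measure (E N)) :=
  withDensity_absolutelyContinuous _ _

lemma absolutelyContinuous_gauss : (volume : Measure (E N)) ≪ gauss N :=
  withDensity_absolutelyContinuous' measurable_ofReal_gaussDensity.aemeasurable
    (Eventually.of_forall fun x => by simpa using gaussDensity_pos x)

instance isLocallyFiniteMeasure_gauss : IsLocallyFiniteMeasure (gauss N) :=
  IsLocallyFiniteMeasure.withDensity_ofReal contDiff_gaussDensity.continuous

instance isFiniteMeasure_gauss_ball : IsFiniteMeasure ((gauss N).restrict (ball 0 R)) :=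
  ⟨by simpa using (isBounded_ball (x := (0 : E N)) (r := R)).measure_lt_top (μ := gauss N)⟩

lemma setIntegral_gauss (s : Set (E N)) (hs : MeasurableSet s) (f : E N → ℝ) :
    ∫ x in s, f x ∂(gauss N) = ∫ x in s, gaussDensity N x * f x := by
  rw [gauss, setIntegral_withDensity_eq_setIntegral_toReal_smul measurable_ofReal_gaussDensity
    (Eventually.of_forall fun _ => ENNReal.ofReal_lt_top) _ hs]
  refine integral_congr_ae (Eventually.of_forall fun x => ?_)
  simp [ENNReal.toReal_ofReal (gaussDensity_pos x).le]

lemma ae_restrict_gauss_iff {s : Set (E N)} (hs : MeasurableSet s) {p : E N → Prop} :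
    (∀ᵐ x ∂(gauss N).restrict s, p x) ↔ ∀ᵐ x ∂(volume : Measure (E N)).restrict s, p x := by
  rw [ae_restrict_iff' hs, ae_restrict_iff' hs]
  exact ⟨fun h => absolutelyContinuous_gauss.ae_le h, fun h => gauss_absolutelyContinuous.ae_le h⟩

lemma exists_bound_on_ball {ψ : E N → ℝ} (hψ : Continuous ψ) (R : ℝ) :
    ∃ C, 0 ≤ C ∧ ∀ x ∈ ball (0 : E N) R, |ψ x| ≤ C := by
  obtain ⟨C, hC⟩ := (isCompact_closedBall (0 : E N) R).exists_bound_of_continuousOn hψ.continuousOn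
  exact ⟨max C 0, le_max_right _ _, fun x hx =>
    (hC x (ball_subset_closedBall hx)).trans (le_max_left _ _)⟩

lemma Integrable.mul_continuous {u : E N → ℝ} (hu : Integrable u ((gauss N).restrict (ball 0 R)))
    {ψ : E N → ℝ} (hψ : Continuous ψ) :
    Integrable (fun x => u x * ψ x) ((gauss N).restrict (ball 0 R)) := by
  obtain ⟨C, -, hC⟩ := exists_bound_on_ball hψ R
  refine hu.mul_bdd (c := C) hψ.aestronglyMeasurable ?_
  filter_upwards [ae_restrict_mem measurableSet_ball] with x hx using hC x hx

lemma integrable_of_continuous {ψ : E N → ℝ} (hψ : Continuous ψ) :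
    Integrable ψ ((gauss N).restrict (ball 0 R)) := by
  simpa using GaussNeumann.Integrable.mul_continuous (integrable_const (1 : ℝ)) hψ

lemma memLp_of_continuous {F : Type*} [NormedAddCommGroup F] [SecondCountableTopology F]
    {ψ : E N → F} (hψ : Continuous ψ) :
    MemLp ψ 2 ((gauss N).restrict (ball 0 R)) := by
  obtain ⟨C, -, hC⟩ := exists_bound_on_ball hψ.norm R
  refine MemLp.of_bound hψ.aestronglyMeasurable C ?_
  filter_upwards [ae_restrict_mem measurableSet_ball] with x hx
  simpa using hC x hx

lemma MemH1.integrable {u : E N → ℝ} {G : E N → E N} (h : MemH1 (ball 0 R) u G) :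
    Integrable u ((gauss N).restrict (ball 0 R)) := h.2.1.integrable (by norm_num)

lemma MemH1.integrable_grad {u : E N → ℝ} {G : E N → E N} (h : MemH1 (ball 0 R) u G) :
    Integrable G ((gauss N).restrict (ball 0 R)) := h.2.2.integrable (by norm_num)

/-! ### The weak formulation against vector fields -/

/-- Testing the Lebesgue weak gradient with the density times `ψ` produces the Gaussian drift term.
-/
lemma MemH1.integral_mul_div {u : E N → ℝ} {G : E N → E N} (h : MemH1 (ball 0 R) u G)
    {ψ : E N → ℝ} (hψ : ContDiff ℝ ∞ ψ) (hc : HasCompactSupport ψ) (hs : tsupport ψ ⊆ ball 0 R)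
    (e : E N) :
    ∫ x in ball 0 R, u x * (fderiv ℝ ψ x e - inner ℝ x e * ψ x) ∂(gauss N)
      = -∫ x in ball 0 R, inner ℝ (G x) e * ψ x ∂(gauss N) := by
  have h1 := h.1.2.2 (fun x => gaussDensity N x * ψ x) (contDiff_gaussDensity.mul hψ)
    (hc.mul_left) (tsupport_mul_subset_right.trans hs) e
  rw [setIntegral_gauss _ measurableSet_ball, setIntegral_gauss _ measurableSet_ball]
  convert h1 using 2
  · refine funext fun x => ?_
    have h2 := (contDiff_gaussDensity.differentiable (by simp) x).hasFDerivAt.mul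
      (hψ.differentiable (by simp) x).hasFDerivAt
    have h3 : fderiv ℝ (fun x => gaussDensity N x * ψ x) x = _ := h2.fderiv
    rw [h3]
    simp only [add_apply, smul_apply, smul_eq_mul,
      fderiv_gaussDensity]
    ring
  · refine integral_congr_ae (Eventually.of_forall fun x => ?_)
    simp only; ring

lemma sum_single (x : E N) : ∑ i, x i • EuclideanSpace.single i (1 : ℝ) = x := by
  ext j
  simp [Finset.sum_apply, Pi.single_apply]

lemma clm_apply_eq_sum (L : E N →L[ℝ] ℝ) (x : E N) :
    L x = ∑ i, x i * L (EuclideanSpace.single i 1) := by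
  conv_lhs => rw [← sum_single x]
  simp [map_sum]

/-- The Ornstein–Uhlenbeck operator `Δ v - x · ∇ v`. -/
noncomputable def ouOp (v : E N → ℝ) (x : E N) : ℝ :=
  ∑ i, fderiv ℝ (fun y => fderiv ℝ v y (EuclideanSpace.single i 1)) x (EuclideanSpace.single i 1)
    - fderiv ℝ v x x

lemma contDiff_fderiv_apply {v : E N → ℝ} (hv : ContDiff ℝ ∞ v) (e : E N) :
    ContDiff ℝ ∞ fun y => fderiv ℝ v y e :=
  (hv.fderiv_right (m := ∞) (by simp)).clm_apply contDiff_const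

lemma continuous_fderiv_self {v : E N → ℝ} (hv : ContDiff ℝ ∞ v) :
    Continuous fun y => fderiv ℝ v y y :=
  (hv.continuous_fderiv (by simp)).clm_apply continuous_id

lemma continuous_ouOp {v : E N → ℝ} (hv : ContDiff ℝ ∞ v) : Continuous (ouOp v) := by
  unfold ouOp
  refine Continuous.sub (continuous_finsetSum _ fun i _ => ?_) (continuous_fderiv_self hv)
  exact (contDiff_fderiv_apply (contDiff_fderiv_apply hv _) _).continuous

/-- The bound on `t η' t` is invariant under scaling, so it survives when `η` is compressed towards
the sphere. -/
lemma exists_cutoff : ∃ η : ℝ → ℝ, ContDiff ℝ ∞ η ∧ (∀ t ≤ 1, η t = 0) ∧ (∀ t, 2 ≤ t → η t = 1) ∧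
    (∀ t, |η t| ≤ 1) ∧ (∀ t, 2 < t → deriv η t = 0) ∧ ∃ B, ∀ t, |t * deriv η t| ≤ B := by
  have hs : ContDiff ℝ ∞ fun t : ℝ => Real.smoothTransition (t - 1) :=
    Real.smoothTransition.contDiff.comp (contDiff_id.sub contDiff_const)
  have h1 : ∀ t : ℝ, t ≤ 1 → Real.smoothTransition (t - 1) = 0 := fun t ht =>
    Real.smoothTransition.zero_of_nonpos (by linarith)
  have h2 : ∀ t : ℝ, 2 ≤ t → Real.smoothTransition (t - 1) = 1 := fun t ht =>
    Real.smoothTransition.one_of_one_le (by linarith)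
  have h3 : ∀ t : ℝ, 2 < t → deriv (fun t : ℝ => Real.smoothTransition (t - 1)) t = 0 := by
    intro t ht
    have : (fun t : ℝ => Real.smoothTransition (t - 1)) =ᶠ[𝓝 t] fun _ => 1 := by
      filter_upwards [lt_mem_nhds ht] with s hs using h2 s hs.le
    rw [this.deriv_eq, deriv_const]
  have h4 : ∀ t : ℝ, t < 1 → deriv (fun t : ℝ => Real.smoothTransition (t - 1)) t = 0 := by
    intro t ht
    have : (fun t : ℝ => Real.smoothTransition (t - 1)) =ᶠ[𝓝 t] fun _ => 0 := by
      filter_upwards [gt_mem_nhds ht] with s hs using h1 s hs.le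
    rw [this.deriv_eq, deriv_const]
  refine ⟨_, hs, h1, h2, fun t => ?_, h3, ?_⟩
  · rw [abs_of_nonneg (Real.smoothTransition.nonneg _)]
    exact Real.smoothTransition.le_one _
  · have hc : Continuous fun t => t * deriv (fun t : ℝ => Real.smoothTransition (t - 1)) t :=
      continuous_id.mul (contDiff_deriv hs).continuous
    obtain ⟨B, hB⟩ := (isCompact_Icc (a := (1 : ℝ)) (b := 2)).exists_bound_of_continuousOn
      hc.continuousOn
    refine ⟨max B 0, fun t => ?_⟩
    rcases lt_or_ge t 1 with ht | ht
    · rw [h4 t ht]; simp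
    rcases lt_or_ge 2 t with ht' | ht'
    · rw [h3 t ht']; simp
    · exact (hB t ⟨ht, ht'⟩).trans (le_max_left _ _)

/-- Green's formula for a smooth `v` whose normal derivative vanishes on the sphere. -/
theorem MemH1.green (hR : 0 < R) {u : E N → ℝ} {G : E N → E N} (h : MemH1 (ball 0 R) u G)
    {v : E N → ℝ} (hv : ContDiff ℝ ∞ v) {C : ℝ}
    (hD : ∀ x ∈ ball (0 : E N) R, |fderiv ℝ v x x| ≤ C * (R ^ 2 - ‖x‖ ^ 2)) :
    ∫ x in ball 0 R, fderiv ℝ v x (G x) ∂(gauss N)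
      = -∫ x in ball 0 R, u x * ouOp v x ∂(gauss N) := by
  obtain ⟨η, hη, hη0, hη1, hηb, hη', B, hB⟩ := exists_cutoff
  set γ := (gauss N).restrict (ball 0 R) with hγ
  have hu : Integrable u γ := h.integrable
  have hG : Integrable G γ := h.integrable_grad
  set e : Fin N → E N := fun i => EuclideanSpace.single i 1 with he
  -- Compactly supported cutoffs exhausting the ball; they replace any theory of boundary traces.
  set χ : ℕ → E N → ℝ := fun n x => η (((n : ℝ) + 1) * (R ^ 2 - ‖x‖ ^ 2)) with hχ
  have hin : ContDiff ℝ ∞ fun x : E N => ‖x‖ ^ 2 := contDiff_norm_sq ℝ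
  have hχs : ∀ n, ContDiff ℝ ∞ (χ n) := fun n =>
    hη.comp (contDiff_const.mul (contDiff_const.sub hin))
  have hχd : ∀ n x y, fderiv ℝ (χ n) x y
      = -(2 * ((n : ℝ) + 1) * deriv η (((n : ℝ) + 1) * (R ^ 2 - ‖x‖ ^ 2)) * inner ℝ x y) := by
    intro n x y
    have h1 := ((hasFDerivAt_norm_sq x).const_sub (R ^ 2)).const_mul ((n : ℝ) + 1)
    have h2 := (hasDerivAt_of_contDiff hη
      (((n : ℝ) + 1) * (R ^ 2 - ‖x‖ ^ 2))).comp_hasFDerivAt x h1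
    have h3 : fderiv ℝ (χ n) x = _ := h2.fderiv
    rw [h3]
    simp
    ring
  have hχsupp : ∀ n, tsupport (χ n) ⊆ ball 0 R ∩ closedBall 0 R := by
    intro n
    have h1 : IsClosed {x : E N | 1 ≤ ((n : ℝ) + 1) * (R ^ 2 - ‖x‖ ^ 2)} :=
      isClosed_le continuous_const (by fun_prop)
    have h2 : tsupport (χ n) ⊆ {x : E N | 1 ≤ ((n : ℝ) + 1) * (R ^ 2 - ‖x‖ ^ 2)} := by
      refine closure_minimal (fun x hx => ?_) h1
      by_contra hcon
      exact hx (hη0 _ (not_le.1 hcon).le)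
    intro x hx
    have h3 : 1 ≤ ((n : ℝ) + 1) * (R ^ 2 - ‖x‖ ^ 2) := h2 hx
    have h4 : 0 < R ^ 2 - ‖x‖ ^ 2 :=
      pos_of_mul_pos_right (one_pos.trans_le h3) (by positivity)
    have h5 : ‖x‖ < R := by
      have := sq_lt_sq.1 (show ‖x‖ ^ 2 < R ^ 2 by linarith)
      rwa [abs_norm, abs_of_pos hR] at this
    simp [h5, h5.le]
  have hχc : ∀ n, HasCompactSupport (χ n) := fun n =>
    HasCompactSupport.of_support_subset_isCompact (isCompact_closedBall (0 : E N) R)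
      ((subset_tsupport _).trans ((hχsupp n).trans inter_subset_right))
  have hdi : ∀ i, ContDiff ℝ ∞ fun y => fderiv ℝ v y (e i) := fun i => contDiff_fderiv_apply hv _
  have hid : ∀ n : ℕ, ∫ x, u x * (χ n x * ouOp v x - 2 * ((n : ℝ) + 1) *
        deriv η (((n : ℝ) + 1) * (R ^ 2 - ‖x‖ ^ 2)) * fderiv ℝ v x x) ∂γ
      = -∫ x, χ n x * fderiv ℝ v x (G x) ∂γ := by
    intro n
    have h1 : ∀ i, _ := fun i => h.integral_mul_div (ψ := fun x => χ n x * fderiv ℝ v x (e i))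
      ((hχs n).mul (hdi i)) ((hχc n).mul_right)
      (tsupport_mul_subset_left.trans ((hχsupp n).trans inter_subset_left)) (e i)
    have h2 := Finset.sum_congr rfl fun i (_ : i ∈ Finset.univ) => h1 i
    rw [Finset.sum_neg_distrib, ← integral_finsetSum, ← integral_finsetSum] at h2
    · refine Eq.trans ?_ (h2.trans (congrArg Neg.neg ?_))
      · refine integral_congr_ae (ae_of_all γ fun x => ?_)
        simp only
        rw [← Finset.mul_sum]
        congr 1
        have h3 : ∀ i, fderiv ℝ (fun x => χ n x * fderiv ℝ v x (e i)) x (e i)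
            = χ n x * fderiv ℝ (fun x => fderiv ℝ v x (e i)) x (e i)
              + fderiv ℝ v x (e i) * fderiv ℝ (χ n) x (e i) := by
          intro i
          have h4 := ((hχs n).differentiable (by simp) x).hasFDerivAt.mul
            ((hdi i).differentiable (by simp) x).hasFDerivAt
          have h5 : fderiv ℝ (fun x => χ n x * fderiv ℝ v x (e i)) x = _ := h4.fderiv
          rw [h5]; simp
        have h6 : ∀ i, inner ℝ x (e i) = x i := by
          intro i; simp [he, EuclideanSpace.inner_single_right]
        simp only [h3, hχd, h6, ouOp]
        rw [clm_apply_eq_sum (fderiv ℝ v x) x, Finset.sum_sub_distrib, Finset.sum_add_distrib,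
          mul_sub, Finset.mul_sum, Finset.mul_sum, Finset.mul_sum]
        have h7 : ∑ i, fderiv ℝ v x (e i) * -(2 * ((n : ℝ) + 1) *
              deriv η (((n : ℝ) + 1) * (R ^ 2 - ‖x‖ ^ 2)) * x i)
            = - ∑ i, 2 * ((n : ℝ) + 1) * deriv η (((n : ℝ) + 1) * (R ^ 2 - ‖x‖ ^ 2)) *
              (x i * fderiv ℝ v x (e i)) := by
          rw [← Finset.sum_neg_distrib]; exact Finset.sum_congr rfl fun i _ => by ring
        have h8 : ∑ i, x i * (χ n x * fderiv ℝ v x (e i))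
            = ∑ i, χ n x * (x i * fderiv ℝ v x (e i)) :=
          Finset.sum_congr rfl fun i _ => by ring
        rw [h7, h8]; ring
      · rw [← hγ]
        have h9 : ∀ x, χ n x * fderiv ℝ v x (G x)
            = ∑ i, inner ℝ (G x) (e i) * (χ n x * fderiv ℝ v x (e i)) := by
          intro x
          rw [clm_apply_eq_sum (fderiv ℝ v x) (G x), Finset.mul_sum]
          refine Finset.sum_congr rfl fun i _ => ?_
          simp only [he, EuclideanSpace.inner_single_right]
          simp; ring
        simp only [h9]
    · intro i _
      exact GaussNeumann.Integrable.mul_continuous (hG.inner_const (e i))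
        ((hχs n).continuous.mul (hdi i).continuous)
    · intro i _
      refine GaussNeumann.Integrable.mul_continuous hu (Continuous.sub ?_ ?_)
      · exact (contDiff_fderiv_apply ((hχs n).mul (hdi i)) (e i)).continuous
      · exact (by fun_prop : Continuous fun x : E N => inner ℝ x (e i)).mul
          ((hχs n).continuous.mul (hdi i).continuous)
  obtain ⟨C₁, hC₁0, hC₁⟩ := exists_bound_on_ball (continuous_ouOp hv) R
  have hvc := hv.continuous_fderiv (by simp : (∞ : WithTop ℕ∞) ≠ 0)
  obtain ⟨C₂, hC₂0, hC₂⟩ := exists_bound_on_ball hvc.norm R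
  have hGm : AEStronglyMeasurable (fun x => fderiv ℝ v x (G x)) γ :=
    (isBoundedBilinearMap_apply.continuous :
      Continuous fun p : (E N →L[ℝ] ℝ) × E N => p.1 p.2).comp_aestronglyMeasurable
        (hvc.aestronglyMeasurable.prodMk hG.aestronglyMeasurable)
  have hmem : ∀ᵐ x ∂γ, x ∈ ball (0 : E N) R := ae_restrict_mem measurableSet_ball
  have hlarge : ∀ x ∈ ball (0 : E N) R, ∀ᶠ n : ℕ in atTop,
      2 < ((n : ℝ) + 1) * (R ^ 2 - ‖x‖ ^ 2) := by
    intro x hx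
    have h1 : ‖x‖ < R := by simpa using hx
    have h2 : 0 < R ^ 2 - ‖x‖ ^ 2 := by nlinarith [norm_nonneg x]
    obtain ⟨n, hn⟩ := exists_nat_gt (2 / (R ^ 2 - ‖x‖ ^ 2))
    filter_upwards [eventually_ge_atTop n] with m hm
    rw [div_lt_iff₀ h2] at hn
    have : (n : ℝ) ≤ m := by exact_mod_cast hm
    nlinarith
  -- The derivative of the cutoff grows like `n + 1`, but `hD` supplies the factor `R ^ 2 - |x| ^
  -- 2`, so the product is bounded by means of `B`; it tends to zero pointwise.
  have lim1 : Tendsto (fun n : ℕ => ∫ x, u x * (χ n x * ouOp v x - 2 * ((n : ℝ) + 1) *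
        deriv η (((n : ℝ) + 1) * (R ^ 2 - ‖x‖ ^ 2)) * fderiv ℝ v x x) ∂γ) atTop
      (𝓝 (∫ x, u x * ouOp v x ∂γ)) := by
    refine tendsto_integral_of_dominated_convergence (fun x => |u x| * (C₁ + 2 * (|C| * B)))
      (fun n => ?_) (hu.abs.mul_const _) (fun n => ?_) ?_
    · refine hu.aestronglyMeasurable.mul (Continuous.aestronglyMeasurable ?_)
      have h1 := (contDiff_deriv hη).continuous
      have h2 := continuous_ouOp hv
      have h3 := continuous_fderiv_self hv
      have h4 := (hχs n).continuous
      fun_prop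
    · filter_upwards [hmem] with x hx
      rw [norm_mul, Real.norm_eq_abs, Real.norm_eq_abs]
      refine mul_le_mul_of_nonneg_left ((abs_sub _ _).trans (add_le_add ?_ ?_)) (abs_nonneg _)
      · rw [abs_mul]
        calc _ ≤ 1 * C₁ := mul_le_mul (hηb _) (hC₁ x hx) (abs_nonneg _) zero_le_one
          _ = C₁ := one_mul _
      · have h1 : ‖x‖ < R := by simpa using hx
        have h2 : 0 < R ^ 2 - ‖x‖ ^ 2 := by nlinarith [norm_nonneg x]
        have h3 := hB (((n : ℝ) + 1) * (R ^ 2 - ‖x‖ ^ 2))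
        rw [abs_mul, abs_of_pos (by positivity)] at h3
        have h4 : |fderiv ℝ v x x| ≤ |C| * (R ^ 2 - ‖x‖ ^ 2) :=
          (hD x hx).trans (mul_le_mul_of_nonneg_right (le_abs_self C) h2.le)
        rw [abs_mul, abs_mul, abs_of_pos (by positivity : 0 < 2 * ((n : ℝ) + 1))]
        calc 2 * ((n : ℝ) + 1) * |deriv η (((n : ℝ) + 1) * (R ^ 2 - ‖x‖ ^ 2))| * |fderiv ℝ v x x|
            ≤ 2 * ((n : ℝ) + 1) * |deriv η (((n : ℝ) + 1) * (R ^ 2 - ‖x‖ ^ 2))| *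
              (|C| * (R ^ 2 - ‖x‖ ^ 2)) := by gcongr
          _ = 2 * (|C| * (((n : ℝ) + 1) * (R ^ 2 - ‖x‖ ^ 2) *
              |deriv η (((n : ℝ) + 1) * (R ^ 2 - ‖x‖ ^ 2))|)) := by ring
          _ ≤ 2 * (|C| * B) := by gcongr
    · filter_upwards [hmem] with x hx
      refine tendsto_const_nhds.congr' ?_
      filter_upwards [hlarge x hx] with n hn
      simp only [hχ]
      rw [hη1 _ hn.le, hη' _ hn]; ring
  have lim2 : Tendsto (fun n : ℕ => ∫ x, χ n x * fderiv ℝ v x (G x) ∂γ) atTop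
      (𝓝 (∫ x, fderiv ℝ v x (G x) ∂γ)) := by
    refine tendsto_integral_of_dominated_convergence (fun x => C₂ * ‖G x‖)
      (fun n => (hχs n).continuous.aestronglyMeasurable.mul hGm) (hG.norm.const_mul _)
      (fun n => ?_) ?_
    · filter_upwards [hmem] with x hx
      rw [norm_mul]
      have h1 := hC₂ x hx
      rw [abs_norm] at h1
      calc _ ≤ 1 * (C₂ * ‖G x‖) := by
            refine mul_le_mul (hηb _) (((fderiv ℝ v x).le_opNorm _).trans ?_) (norm_nonneg _)
              zero_le_one
            gcongr
        _ = _ := one_mul _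
    · filter_upwards [hmem] with x hx
      refine tendsto_const_nhds.congr' ?_
      filter_upwards [hlarge x hx] with n hn
      simp only [hχ]
      rw [hη1 _ hn.le, one_mul]
  have := tendsto_nhds_unique lim1 (by simpa only [hid] using lim2.neg)
  rw [this, neg_neg]

/-! ### Smooth functions -/

lemma memH1_of_contDiff {v : E N → ℝ} (hv : ContDiff ℝ ∞ v) :
    MemH1 (ball 0 R) v (gradient v) := by
  have hg : Continuous (gradient v) := by
    unfold gradient
    exact (LinearIsometryEquiv.continuous _).comp (hv.continuous_fderiv (by simp))
  refine ⟨⟨hv.continuous.locallyIntegrable.locallyIntegrableOn _,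
    hg.locallyIntegrable.locallyIntegrableOn _, fun φ hφ hφc hφs e => ?_⟩,
    memLp_of_continuous hv.continuous, memLp_of_continuous hg⟩
  have hz : ∀ x ∉ ball (0 : E N) R, φ x = 0 := fun x hx =>
    image_eq_zero_of_notMem_tsupport fun h => hx (hφs h)
  have hz' : ∀ x ∉ ball (0 : E N) R, fderiv ℝ φ x e = 0 := fun x hx => by
    have : x ∉ tsupport (fderiv ℝ φ) := fun h => hx (hφs (tsupport_fderiv_subset ℝ h))
    rw [image_eq_zero_of_notMem_tsupport this]; rfl
  rw [setIntegral_eq_integral_of_forall_compl_eq_zero (fun x hx => by rw [hz' x hx, mul_zero]),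
    setIntegral_eq_integral_of_forall_compl_eq_zero (fun x hx => by rw [hz x hx, mul_zero])]
  simp only [inner_gradient_left]
  have hd := (contDiff_fderiv_apply hv e).continuous
  have hd' := (contDiff_fderiv_apply hφ e).continuous
  refine integral_mul_fderiv_eq_neg_fderiv_mul_of_integrable ?_ ?_ ?_
    (fun x _ => hv.differentiable (by simp) x) (fun x _ => hφ.differentiable (by simp) x)
  · exact (hd.mul hφ.continuous).integrable_of_hasCompactSupport hφc.mul_left
  · exact (hv.continuous.mul hd').integrable_of_hasCompactSupport
      (hφc.fderiv_apply ℝ e).mul_left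
  · exact (hv.continuous.mul hφ.continuous).integrable_of_hasCompactSupport hφc.mul_left

open MvPolynomial

/-! ### Polynomial functions on Euclidean space -/

/-- The function on Euclidean space defined by a polynomial. -/
noncomputable def polyFun (P : MvPolynomial (Fin N) ℝ) (x : E N) : ℝ := eval (fun i => x i) P

lemma polyFun_add (P Q : MvPolynomial (Fin N) ℝ) (x : E N) :
    polyFun (P + Q) x = polyFun P x + polyFun Q x := by simp [polyFun]

lemma polyFun_mul (P Q : MvPolynomial (Fin N) ℝ) (x : E N) :
    polyFun (P * Q) x = polyFun P x * polyFun Q x := by simp [polyFun]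

lemma polyFun_smul (c : ℝ) (P : MvPolynomial (Fin N) ℝ) (x : E N) :
    polyFun (c • P) x = c * polyFun P x := by simp [polyFun]

lemma polyFun_sum {ι : Type*} (s : Finset ι) (P : ι → MvPolynomial (Fin N) ℝ) (x : E N) :
    polyFun (∑ i ∈ s, P i) x = ∑ i ∈ s, polyFun (P i) x := by simp [polyFun]

lemma polyFun_X (i : Fin N) (x : E N) : polyFun (X i) x = x i := by simp [polyFun]

lemma hasFDerivAt_polyFun (P : MvPolynomial (Fin N) ℝ) (x : E N) :
    HasFDerivAt (polyFun P)
      (∑ i, polyFun (pderiv i P) x • (EuclideanSpace.proj i : E N →L[ℝ] ℝ)) x := by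
  induction P using MvPolynomial.induction_on with
  | C a =>
    simp only [pderiv_C]
    have : (polyFun (C a) : E N → ℝ) = fun _ => a := by ext y; simp [polyFun]
    rw [this]
    convert! hasFDerivAt_const (𝕜 := ℝ) a x
    simp [polyFun]
  | add P Q hP hQ =>
    have : (polyFun (P + Q) : E N → ℝ) = polyFun P + polyFun Q := by
      ext y; simp [polyFun_add]
    rw [this]
    refine (hP.add hQ).congr_fderiv ?_
    rw [← Finset.sum_add_distrib]
    refine Finset.sum_congr rfl fun i _ => ?_
    rw [map_add, polyFun_add, add_smul]
  | mul_X P j hP =>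
    have : (polyFun (P * X j) : E N → ℝ) = polyFun P * fun y => y j := by
      ext y; simp [polyFun_mul, polyFun_X]
    rw [this]
    have hj : HasFDerivAt (fun y : E N => y j) (EuclideanSpace.proj j : E N →L[ℝ] ℝ) x :=
      (EuclideanSpace.proj j : E N →L[ℝ] ℝ).hasFDerivAt
    refine (hP.mul hj).congr_fderiv ?_
    ext y
    simp only [pderiv_mul, polyFun_add, polyFun_mul, polyFun_X, pderiv_X, add_apply, sum_apply,
      smul_apply, smul_eq_mul, PiLp.proj_apply, add_mul, Finset.sum_add_distrib,
      Finset.mul_sum]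
    rw [add_comm]
    congr 1
    · exact Finset.sum_congr rfl fun i _ => by ring
    · rw [Finset.sum_eq_single j]
      · simp [polyFun]
      · intro i _ hij; simp [polyFun, hij.symm]
      · simp

lemma contDiff_polyFun (P : MvPolynomial (Fin N) ℝ) : ContDiff ℝ ∞ (polyFun P) := by
  induction P using MvPolynomial.induction_on with
  | C a =>
    have : (polyFun (C a) : E N → ℝ) = fun _ => a := by ext y; simp [polyFun]
    rw [this]; exact contDiff_const
  | add P Q hP hQ =>
    have : (polyFun (P + Q) : E N → ℝ) = polyFun P + polyFun Q := by
      ext y; simp [polyFun_add]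
    rw [this]; exact hP.add hQ
  | mul_X P j hP =>
    have : (polyFun (P * X j) : E N → ℝ) = polyFun P * fun y => y j := by
      ext y; simp [polyFun_mul, polyFun_X]
    rw [this]
    exact hP.mul (EuclideanSpace.proj j : E N →L[ℝ] ℝ).contDiff

lemma fderiv_polyFun_single (P : MvPolynomial (Fin N) ℝ) (x : E N) (i : Fin N) :
    fderiv ℝ (polyFun P) x (EuclideanSpace.single i 1) = polyFun (pderiv i P) x := by
  rw [(hasFDerivAt_polyFun P x).fderiv]
  simp

/-- Euler's identity. -/
lemma sum_mul_polyFun_pderiv {P : MvPolynomial (Fin N) ℝ} {k : ℕ} (hP : P.IsHomogeneous k)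
    (x : E N) : ∑ i, x i * polyFun (pderiv i P) x = k * polyFun P x := by
  have := congrArg (fun Q => polyFun Q x) hP.sum_X_mul_pderiv
  simpa [polyFun] using this

lemma sum_sq_eq (x : E N) : ∑ i, x i * x i = ‖x‖ ^ 2 := by
  rw [EuclideanSpace.norm_sq_eq]
  exact Finset.sum_congr rfl fun i _ => by rw [Real.norm_eq_abs, sq_abs, sq]

/-- The formal Laplacian. -/
noncomputable def lap : MvPolynomial (Fin N) ℝ →ₗ[ℝ] MvPolynomial (Fin N) ℝ :=
  ∑ i, (pderiv i).toLinearMap ∘ₗ (pderiv i).toLinearMap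

lemma lap_apply (P : MvPolynomial (Fin N) ℝ) : lap P = ∑ i, pderiv i (pderiv i P) := by
  simp [lap]

/-! ### Functions `g (|x| ^ 2) P x` -/

/-- The function `g (|x| ^ 2) P x`. -/
noncomputable def modeFun (g : ℝ → ℝ) (P : MvPolynomial (Fin N) ℝ) (x : E N) : ℝ :=
  g (‖x‖ ^ 2) * polyFun P x

lemma contDiff_modeFun {g : ℝ → ℝ} (hg : ContDiff ℝ ∞ g) (P : MvPolynomial (Fin N) ℝ) :
    ContDiff ℝ ∞ (modeFun g P) :=
  (hg.comp (contDiff_norm_sq ℝ)).mul (contDiff_polyFun P)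

lemma fderiv_modeFun_single {g : ℝ → ℝ} (hg : ContDiff ℝ ∞ g) (P : MvPolynomial (Fin N) ℝ)
    (x : E N) (i : Fin N) :
    fderiv ℝ (modeFun g P) x (EuclideanSpace.single i 1)
      = 2 * modeFun (deriv g) (X i * P) x + modeFun g (pderiv i P) x := by
  have h1 := (hasDerivAt_of_contDiff hg (‖x‖ ^ 2)).comp_hasFDerivAt x (hasFDerivAt_norm_sq x)
  have h2 : HasFDerivAt (modeFun g P) _ x :=
    h1.mul ((contDiff_polyFun P).differentiable (by simp) x).hasFDerivAt
  rw [h2.fderiv]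
  simp only [add_apply, smul_apply, smul_eq_mul, fderiv_polyFun_single, modeFun, polyFun_mul,
    polyFun_X, innerSL_apply_apply, Function.comp_apply]
  simp [EuclideanSpace.inner_single_right]
  ring

lemma fderiv_modeFun_self {g : ℝ → ℝ} (hg : ContDiff ℝ ∞ g) {P : MvPolynomial (Fin N) ℝ} {k : ℕ}
    (hP : P.IsHomogeneous k) (x : E N) :
    fderiv ℝ (modeFun g P) x x = modeFun (neumannTrace k g) P x := by
  rw [clm_apply_eq_sum]
  simp only [fderiv_modeFun_single hg, mul_add, Finset.sum_add_distrib]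
  have h1 : ∑ i, x i * (2 * modeFun (deriv g) (X i * P) x)
      = 2 * deriv g (‖x‖ ^ 2) * polyFun P x * ∑ i, x i * x i := by
    rw [Finset.mul_sum]
    exact Finset.sum_congr rfl fun i _ => by simp only [modeFun, polyFun_mul, polyFun_X]; ring
  have h2 : ∑ i, x i * modeFun g (pderiv i P) x
      = g (‖x‖ ^ 2) * ∑ i, x i * polyFun (pderiv i P) x := by
    rw [Finset.mul_sum]
    exact Finset.sum_congr rfl fun i _ => by simp only [modeFun]; ring
  rw [h1, h2, sum_sq_eq, sum_mul_polyFun_pderiv hP, modeFun, neumannTrace]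
  ring

/-- Separation of variables: harmonicity removes the term with `Δ P`, and Euler's identity turns `x
· ∇ P` into `k P`. -/
lemma ouOp_modeFun {g : ℝ → ℝ} (hg : ContDiff ℝ ∞ g) {P : MvPolynomial (Fin N) ℝ} {k : ℕ}
    (hP : P.IsHomogeneous k) (hlap : lap P = 0) (x : E N) :
    ouOp (modeFun g P) x = (4 * ‖x‖ ^ 2 * deriv (deriv g) (‖x‖ ^ 2)
      + (4 * (N / 2 + k) - 2 * ‖x‖ ^ 2) * deriv g (‖x‖ ^ 2) - k * g (‖x‖ ^ 2)) * polyFun P x := by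
  have hg' := contDiff_deriv hg
  have h1 : ∀ i, fderiv ℝ (fun y => fderiv ℝ (modeFun g P) y (EuclideanSpace.single i 1)) x
      (EuclideanSpace.single i 1) = 2 * (2 * modeFun (deriv (deriv g)) (X i * (X i * P)) x
        + modeFun (deriv g) (pderiv i (X i * P)) x)
        + (2 * modeFun (deriv g) (X i * pderiv i P) x + modeFun g (pderiv i (pderiv i P)) x) := by
    intro i
    simp only [fderiv_modeFun_single hg]
    have h2 := (((contDiff_modeFun hg' (X i * P)).differentiable (by simp) x).hasFDerivAt.const_mul
      2).add ((contDiff_modeFun hg (pderiv i P)).differentiable (by simp) x).hasFDerivAt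
    have h3 : fderiv ℝ (fun y => 2 * modeFun (deriv g) (X i * P) y + modeFun g (pderiv i P) y) x
      = _ := h2.fderiv
    rw [h3, add_apply, smul_apply, fderiv_modeFun_single hg', fderiv_modeFun_single hg,
      smul_eq_mul]
  have h4 : ∑ i, polyFun (pderiv i (pderiv i P)) x = 0 := by
    rw [← polyFun_sum, ← lap_apply, hlap]; simp [polyFun]
  have h5 : ∀ i, fderiv ℝ (fun y => fderiv ℝ (modeFun g P) y (EuclideanSpace.single i 1)) x
      (EuclideanSpace.single i 1) = 4 * deriv (deriv g) (‖x‖ ^ 2) * polyFun P x * (x i * x i)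
        + 2 * deriv g (‖x‖ ^ 2) * polyFun P x
        + 4 * deriv g (‖x‖ ^ 2) * (x i * polyFun (pderiv i P) x)
        + g (‖x‖ ^ 2) * polyFun (pderiv i (pderiv i P)) x := by
    intro i
    rw [h1]
    simp only [modeFun, pderiv_mul, pderiv_X_self, polyFun_mul, polyFun_X, polyFun_add, one_mul]
    ring
  rw [ouOp, fderiv_modeFun_self hg hP, modeFun, neumannTrace, Finset.sum_congr rfl fun i _ => h5 i]
  simp only [Finset.sum_add_distrib, ← Finset.mul_sum, h4, sum_sq_eq, sum_mul_polyFun_pderiv hP]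
  simp
  ring

/-! ### Harmonic decomposition of polynomials -/

/-- Homogeneous harmonic polynomials. -/
def IsHarmonic (k : ℕ) (P : MvPolynomial (Fin N) ℝ) : Prop := P.IsHomogeneous k ∧ lap P = 0

/-- The polynomial `|x| ^ 2`. -/
noncomputable def normSqPoly (N : ℕ) : MvPolynomial (Fin N) ℝ := ∑ i, X i * X i

lemma polyFun_normSqPoly (x : E N) : polyFun (normSqPoly N) x = ‖x‖ ^ 2 := by
  simp only [normSqPoly, polyFun_sum, polyFun_mul, polyFun_X, sum_sq_eq]

lemma isHomogeneous_normSqPoly : (normSqPoly N).IsHomogeneous 2 :=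
  IsHomogeneous.sum _ _ _ fun i _ => (isHomogeneous_X ℝ i).mul (isHomogeneous_X ℝ i)

lemma pderiv_normSqPoly (i : Fin N) : pderiv i (normSqPoly N) = 2 * X i := by
  simp only [normSqPoly, map_sum, pderiv_mul, pderiv_X]
  rw [Finset.sum_eq_single i]
  · simp; ring
  · intro j _ hj; simp [hj.symm]
  · simp

lemma lap_normSqPoly_mul {Q : MvPolynomial (Fin N) ℝ} {n : ℕ} (hQ : Q.IsHomogeneous n) :
    lap (normSqPoly N * Q) = (2 * N + 4 * n : ℝ) • Q + normSqPoly N * lap Q := by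
  have h1 : ∀ i, pderiv i (pderiv i (normSqPoly N * Q)) =
      2 * Q + 4 * (X i * pderiv i Q) + normSqPoly N * pderiv i (pderiv i Q) := by
    intro i
    have h2 : pderiv i (2 : MvPolynomial (Fin N) ℝ) = 0 :=
      Derivation.map_natCast (pderiv i) 2
    simp only [pderiv_mul, pderiv_normSqPoly, map_add, pderiv_X_self, h2]
    ring
  rw [lap_apply, lap_apply, Finset.sum_congr rfl fun i _ => h1 i, Finset.sum_add_distrib,
    Finset.sum_add_distrib, ← Finset.mul_sum, ← Finset.mul_sum, ← Finset.mul_sum,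
    hQ.sum_X_mul_pderiv]
  simp only [Finset.sum_const, Finset.card_univ, Fintype.card_fin, nsmul_eq_mul, smul_eq_C_mul,
    map_add, map_mul, map_natCast, map_ofNat]
  ring

/-- Since the constant is nonzero, the Laplacian can be inverted explicitly on these products. -/
lemma exists_lap_normSqPoly_pow (hN : 1 ≤ N) {k : ℕ} {P : MvPolynomial (Fin N) ℝ}
    (hP : IsHarmonic k P) (m : ℕ) :
    ∃ c : ℝ, 0 < c ∧ lap (normSqPoly N ^ (m + 1) * P) = c • (normSqPoly N ^ m * P) := by
  have hN' : (0 : ℝ) < N := by exact_mod_cast hN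
  induction m with
  | zero =>
    refine ⟨2 * N + 4 * k, by positivity, ?_⟩
    simpa [hP.2] using lap_normSqPoly_mul hP.1
  | succ m ih =>
    obtain ⟨c, hc, h⟩ := ih
    have h1 := lap_normSqPoly_mul ((isHomogeneous_normSqPoly (N := N).pow (m + 1)).mul hP.1)
    refine ⟨2 * N + 4 * ((2 * (m + 1) + k : ℕ) : ℝ) + c, by positivity, ?_⟩
    rw [pow_succ' _ (m + 1), mul_assoc, h1, h, mul_smul_comm, pow_succ' _ m, mul_assoc,
      ← add_smul]

/-- The products `|x| ^ (2 m) P` of degree `n` with `P` harmonic. -/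
def harmonicProducts (N n : ℕ) : Set (MvPolynomial (Fin N) ℝ) :=
  {Q | ∃ m k P, 2 * m + k = n ∧ IsHarmonic k P ∧ Q = normSqPoly N ^ m * P}

lemma isHomogeneous_of_mem_span {n : ℕ} {Q : MvPolynomial (Fin N) ℝ}
    (hQ : Q ∈ Submodule.span ℝ (harmonicProducts N n)) : Q.IsHomogeneous n := by
  rw [← mem_homogeneousSubmodule]
  refine Submodule.span_le.2 ?_ hQ
  rintro _ ⟨m, k, P, rfl, hP, rfl⟩
  exact (isHomogeneous_normSqPoly.pow m).mul hP.1

lemma exists_lap_eq (hN : 1 ≤ N) {n : ℕ} {T : MvPolynomial (Fin N) ℝ}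
    (hT : T ∈ Submodule.span ℝ (harmonicProducts N n)) :
    ∃ Q ∈ Submodule.span ℝ (harmonicProducts N (n + 2)), lap Q = T := by
  have : Submodule.span ℝ (harmonicProducts N n)
      ≤ (Submodule.span ℝ (harmonicProducts N (n + 2))).map lap := by
    refine Submodule.span_le.2 ?_
    rintro _ ⟨m, k, P, rfl, hP, rfl⟩
    obtain ⟨c, hc, h⟩ := exists_lap_normSqPoly_pow hN hP m
    refine ⟨c⁻¹ • (normSqPoly N ^ (m + 1) * P), Submodule.smul_mem _ _ (Submodule.subset_span
      ⟨m + 1, k, P, by ring, hP, rfl⟩), ?_⟩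
    rw [map_smul, h, smul_smul, inv_mul_cancel₀ hc.ne', one_smul]
  exact this hT

/-- By induction `Δ Q`, of degree `n - 2`, lies in the span, so it equals `Δ Q'` with `Q'` in the
span of degree `n`; the difference `Q - Q'` is harmonic. -/
lemma mem_span_harmonicProducts (hN : 1 ≤ N) (n : ℕ) {Q : MvPolynomial (Fin N) ℝ}
    (hQ : Q.IsHomogeneous n) : Q ∈ Submodule.span ℝ (harmonicProducts N n) := by
  induction n using Nat.strong_induction_on generalizing Q with
  | _ n ih =>
  have hharm : ∀ P : MvPolynomial (Fin N) ℝ, P.IsHomogeneous n → lap P = 0 →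
      P ∈ Submodule.span ℝ (harmonicProducts N n) := fun P h1 h2 =>
    Submodule.subset_span ⟨0, n, P, by ring, ⟨h1, h2⟩, by simp⟩
  have hconst : ∀ P : MvPolynomial (Fin N) ℝ, P.IsHomogeneous 0 → ∀ i, pderiv i P = 0 := by
    intro P hP i
    rw [← totalDegree_zero_iff_isHomogeneous, totalDegree_eq_zero_iff_eq_C] at hP
    rw [hP, pderiv_C]
  rcases n with _ | _ | n
  · refine hharm Q hQ ?_
    rw [lap_apply]
    exact Finset.sum_eq_zero fun i _ => by rw [hconst Q hQ, map_zero]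
  · refine hharm Q hQ ?_
    rw [lap_apply]
    exact Finset.sum_eq_zero fun i _ => hconst _ hQ.pderiv i
  · have h1 : (lap Q).IsHomogeneous n := by
      rw [lap_apply]
      exact IsHomogeneous.sum _ _ _ fun i _ => (hQ.pderiv (i := i)).pderiv (i := i)
    obtain ⟨Q', hQ', h2⟩ := exists_lap_eq hN (ih n (by omega) h1)
    have h3 : Q - Q' ∈ Submodule.span ℝ (harmonicProducts N (n + 2)) :=
      hharm _ (hQ.sub (isHomogeneous_of_mem_span hQ')) (by rw [map_sub, h2, sub_self])
    have := Submodule.add_mem _ h3 hQ'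
    rwa [sub_add_cancel] at this

/-- To check a linear property of polynomials it suffices to consider `|x| ^ (2 m) P`, with `P`
harmonic. -/
lemma eq_top_of_harmonicProducts (hN : 1 ≤ N) (V : Submodule ℝ (MvPolynomial (Fin N) ℝ))
    (h : ∀ m k P, IsHarmonic k P → normSqPoly N ^ m * P ∈ V) (Q : MvPolynomial (Fin N) ℝ) :
    Q ∈ V := by
  rw [← sum_homogeneousComponent Q]
  refine Submodule.sum_mem _ fun n _ => ?_
  refine Submodule.span_le.2 ?_
    (mem_span_harmonicProducts hN n (homogeneousComponent_isHomogeneous n Q))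
  rintro _ ⟨m, k, P, -, hP, rfl⟩
  exact h m k P hP

/-! ### Orthogonality to polynomials -/

/-- Approximating a test function within `ε` on `K` bounds its integral against `u` by `ε` times the
`L¹` norm of `u`. Only integrability of `u` is needed. -/
lemma ae_eq_zero_of_uniform_approx {F : Type*} [NormedAddCommGroup F] [NormedSpace ℝ F]
    [FiniteDimensional ℝ F] [MeasurableSpace F] [BorelSpace F] {ν : Measure F} {u : F → ℝ}
    (hu : Integrable u ν) (K : Set F) (hK : ∀ᵐ x ∂ν, x ∈ K) (A : Set (F → ℝ))
    (hAc : ∀ a ∈ A, Continuous a ∧ ∫ x, u x * a x ∂ν = 0)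
    (hA : ∀ g : F → ℝ, Continuous g → ∀ ε > 0, ∃ a ∈ A, ∀ x ∈ K, |a x - g x| ≤ ε) :
    ∀ᵐ x ∂ν, u x = 0 := by
  refine ae_eq_zero_of_integral_contDiff_smul_eq_zero hu.locallyIntegrable fun g hg hgc => ?_
  obtain ⟨C, hC⟩ := hgc.exists_bound_of_continuous hg.continuous
  have hug : Integrable (fun x => u x * g x) ν :=
    hu.mul_bdd hg.continuous.aestronglyMeasurable (Eventually.of_forall hC)
  have hsmall : ∀ ε > 0, |∫ x, u x * g x ∂ν| ≤ ε * ∫ x, |u x| ∂ν := by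
    intro ε hε
    obtain ⟨a, ha, hag⟩ := hA g hg.continuous ε hε
    obtain ⟨hac, h0⟩ := hAc a ha
    have hd : Integrable (fun x => u x * (g x - a x)) ν := by
      refine hu.mul_bdd (c := ε) (hg.continuous.sub hac).aestronglyMeasurable ?_
      filter_upwards [hK] with x hx
      rw [Real.norm_eq_abs, abs_sub_comm]; exact hag x hx
    have hua : Integrable (fun x => u x * a x) ν := by
      refine (hug.sub hd).congr (Eventually.of_forall fun x => ?_)
      simp only [Pi.sub_apply]; ring
    have h1 : ∫ x, u x * g x ∂ν = ∫ x, u x * (g x - a x) ∂ν := by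
      rw [← add_zero (∫ x, u x * (g x - a x) ∂ν), ← h0, ← integral_add hd hua]
      exact integral_congr_ae (Eventually.of_forall fun x => by simp only; ring)
    rw [h1, ← Real.norm_eq_abs, ← integral_const_mul]
    refine norm_integral_le_of_norm_le (hu.abs.const_mul ε) ?_
    filter_upwards [hK] with x hx
    rw [norm_mul, Real.norm_eq_abs, Real.norm_eq_abs, mul_comm]
    refine mul_le_mul_of_nonneg_right ?_ (abs_nonneg _)
    rw [abs_sub_comm]; exact hag x hx
  have h0 : |∫ x, u x * g x ∂ν| ≤ 0 := by
    have hlim : Tendsto (fun ε : ℝ => ε * ∫ x, |u x| ∂ν) (𝓝[>] 0) (𝓝 (0 * ∫ x, |u x| ∂ν)) :=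
      ((continuous_id.mul continuous_const).tendsto' _ _ rfl).mono_left nhdsWithin_le_nhds
    rw [zero_mul] at hlim
    refine ge_of_tendsto hlim ?_
    filter_upwards [self_mem_nhdsWithin] with ε hε using hsmall ε hε
  have h2 := abs_nonpos_iff.1 h0
  rw [← h2]
  exact integral_congr_ae (Eventually.of_forall fun x => by simp only [smul_eq_mul]; ring)

lemma exists_polyFun_near (R : ℝ) {g : E N → ℝ} (hg : Continuous g) {ε : ℝ} (hε : 0 < ε) :
    ∃ Q : MvPolynomial (Fin N) ℝ, ∀ x ∈ closedBall (0 : E N) R, |polyFun Q x - g x| ≤ ε := by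
  let co : Fin N → C(E N, ℝ) := fun i => ⟨fun x => x i, by fun_prop⟩
  let A : Subalgebra ℝ C(E N, ℝ) := (aeval co).range
  have heval : ∀ Q x, (aeval co Q) x = polyFun Q x := by
    intro Q x
    induction Q using MvPolynomial.induction_on with
    | C a => simp [polyFun]
    | add P Q hP hQ => simp [polyFun_add, hP, hQ]
    | mul_X P j hP => rw [map_mul, ContinuousMap.mul_apply, hP, polyFun_mul, polyFun_X]; simp [co]
  have hsep : A.SeparatesPoints := by
    intro x y hxy
    obtain ⟨i, hi⟩ : ∃ i, x i ≠ y i := by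
      by_contra! h
      exact hxy (by ext i; exact h i)
    exact ⟨co i, ⟨co i, ⟨X i, by simp⟩, rfl⟩, hi⟩
  obtain ⟨a, ⟨Q, rfl⟩, ha⟩ :=
    ContinuousMap.exists_mem_subalgebra_near_continuous_of_isCompact_of_separatesPoints
      hsep ⟨g, hg⟩ (isCompact_closedBall (0 : E N) R) hε
  refine ⟨Q, fun x hx => ?_⟩
  have := (ha x hx).le
  rw [Real.norm_eq_abs] at this
  simpa [heval] using this

lemma ae_eq_zero_of_orthogonal_polyFun {u : E N → ℝ}
    (hu : Integrable u ((gauss N).restrict (ball 0 R)))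
    (h : ∀ Q : MvPolynomial (Fin N) ℝ, ∫ x in ball 0 R, u x * polyFun Q x ∂(gauss N) = 0) :
    u =ᵐ[(gauss N).restrict (ball 0 R)] 0 := by
  refine ae_eq_zero_of_uniform_approx hu (closedBall 0 R) ?_ (range polyFun) ?_ ?_
  · filter_upwards [ae_restrict_mem measurableSet_ball] with x hx using ball_subset_closedBall hx
  · rintro _ ⟨Q, rfl⟩
    exact ⟨(contDiff_polyFun Q).continuous, h Q⟩
  · intro g hg ε hε
    obtain ⟨Q, hQ⟩ := exists_polyFun_near R hg hε
    exact ⟨_, ⟨Q, rfl⟩, hQ⟩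

lemma ae_eq_zero_of_orthogonal_harmonic (hN : 1 ≤ N) {u : E N → ℝ}
    (hu : Integrable u ((gauss N).restrict (ball 0 R)))
    (h : ∀ k P, IsHarmonic k P → ∀ p : Polynomial ℝ,
      ∫ x in ball 0 R, u x * modeFun (fun s => p.eval s) P x ∂(gauss N) = 0) :
    u =ᵐ[(gauss N).restrict (ball 0 R)] 0 := by
  refine ae_eq_zero_of_orthogonal_polyFun hu fun Q => ?_
  have hint : ∀ Q : MvPolynomial (Fin N) ℝ,
      Integrable (fun x => u x * polyFun Q x) ((gauss N).restrict (ball 0 R)) := fun Q =>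
    GaussNeumann.Integrable.mul_continuous hu (contDiff_polyFun Q).continuous
  let V : Submodule ℝ (MvPolynomial (Fin N) ℝ) :=
    { carrier := {Q | ∫ x in ball 0 R, u x * polyFun Q x ∂(gauss N) = 0}
      add_mem' := fun {P Q} hP hQ => by
        simp only [mem_ofPred_eq, polyFun_add, mul_add] at hP hQ ⊢
        rw [integral_add (hint P) (hint Q), hP, hQ, add_zero]
      zero_mem' := by simp [polyFun]
      smul_mem' := fun c P hP => by
        simp only [mem_ofPred_eq, polyFun_smul] at hP ⊢
        simp only [mul_left_comm _ c]
        rw [integral_const_mul, hP, mul_zero] }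
  refine eq_top_of_harmonicProducts hN V (fun m k P hP => ?_) Q
  have := h k P hP (Polynomial.X ^ m)
  change ∫ x in ball 0 R, u x * polyFun (normSqPoly N ^ m * P) x ∂(gauss N) = 0
  have hpow : ∀ x : E N, polyFun (normSqPoly N ^ m) x = (‖x‖ ^ 2) ^ m := fun x => by
    rw [← polyFun_normSqPoly]; simp [polyFun]
  simpa [modeFun, polyFun_mul, hpow] using this

/-! ### Eigenfunctions tested against smooth functions -/

/-- Smooth functions with vanishing normal derivative on the sphere of radius `R`. -/
def IsNeumannTest (R : ℝ) (v : E N → ℝ) : Prop :=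
  ContDiff ℝ ∞ v ∧ ∃ C, ∀ x ∈ ball (0 : E N) R, |fderiv ℝ v x x| ≤ C * (R ^ 2 - ‖x‖ ^ 2)

/-- Solutions of the eigenvalue equation in the very weak sense. -/
def IsVeryWeakSolution (R μ : ℝ) (u : E N → ℝ) : Prop :=
  Integrable u ((gauss N).restrict (ball 0 R)) ∧ ∀ v, IsNeumannTest R v →
    ∫ x in ball 0 R, u x * (ouOp v x + μ * v x) ∂(gauss N) = 0

/-- Green's formula moves all derivatives onto the test function, so the weak gradient of `u`
disappears. -/
lemma IsNeumannEigenfunction.isVeryWeakSolution (hR : 0 < R) {μ : ℝ} {u : E N → ℝ}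
    (h : IsNeumannEigenfunction (ball 0 R) μ u) : IsVeryWeakSolution R μ u := by
  obtain ⟨-, G, hG, hw⟩ := h
  have hu := hG.integrable
  refine ⟨hu, fun v hv => ?_⟩
  obtain ⟨hvs, C, hC⟩ := hv
  have h1 := hw v _ (memH1_of_contDiff hvs)
  simp only [inner_gradient_right, conj_trivial] at h1
  rw [hG.green hR hvs hC] at h1
  have i1 := GaussNeumann.Integrable.mul_continuous hu (continuous_ouOp hvs)
  have i2 := GaussNeumann.Integrable.mul_continuous hu hvs.continuous
  have h2 : ∀ x, u x * (ouOp v x + μ * v x) = u x * ouOp v x + μ * (u x * v x) := fun x => by ring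
  simp only [h2]
  rw [integral_add i1 (i2.const_mul μ), integral_const_mul]
  linarith

lemma IsVeryWeakSolution.sub {μ : ℝ} {u u' : E N → ℝ} (h : IsVeryWeakSolution R μ u)
    (h' : IsVeryWeakSolution R μ u') : IsVeryWeakSolution R μ (fun x => u x - u' x) := by
  refine ⟨h.1.sub h'.1, fun v hv => ?_⟩
  have hc : Continuous fun x => ouOp v x + μ * v x :=
    (continuous_ouOp hv.1).add (continuous_const.mul hv.1.continuous)
  simp only [sub_mul]
  rw [integral_sub (GaussNeumann.Integrable.mul_continuous h.1 hc)
    (GaussNeumann.Integrable.mul_continuous h'.1 hc), h.2 v hv, h'.2 v hv, sub_zero]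

lemma contDiff_neumannTrace {g : ℝ → ℝ} (hg : ContDiff ℝ ∞ g) (k : ℕ) :
    ContDiff ℝ ∞ (neumannTrace k g) :=
  ((contDiff_const.mul contDiff_id).mul (contDiff_deriv hg)).add (contDiff_const.mul hg)

/-- The trace is Lipschitz on `[0, R ^ 2]` and vanishes at `R ^ 2`, which gives the linear decay. -/
lemma isNeumannTest_modeFun {g : ℝ → ℝ} (hg : ContDiff ℝ ∞ g) {P : MvPolynomial (Fin N) ℝ} {k : ℕ}
    (hP : P.IsHomogeneous k) (h0 : neumannTrace k g (R ^ 2) = 0) :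
    IsNeumannTest R (modeFun g P) := by
  refine ⟨contDiff_modeFun hg P, ?_⟩
  have hF := contDiff_neumannTrace hg k
  obtain ⟨L, hL⟩ := (isCompact_Icc (a := (0 : ℝ)) (b := R ^ 2)).exists_bound_of_continuousOn
    (contDiff_deriv hF).continuous.continuousOn
  obtain ⟨B, hB0, hB⟩ := exists_bound_on_ball (contDiff_polyFun P).continuous R
  refine ⟨L * B, fun x hx => ?_⟩
  have hx' : ‖x‖ < R := by simpa using hx
  have hs : ‖x‖ ^ 2 ≤ R ^ 2 := pow_le_pow_left₀ (norm_nonneg _) hx'.le 2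
  have h1 := (convex_Icc (0 : ℝ) (R ^ 2)).norm_image_sub_le_of_norm_deriv_le
    (fun y _ => hF.differentiable (by simp) y) hL
    (show R ^ 2 ∈ Icc 0 (R ^ 2) from ⟨sq_nonneg _, le_rfl⟩)
    (show ‖x‖ ^ 2 ∈ Icc 0 (R ^ 2) from ⟨sq_nonneg _, hs⟩)
  rw [h0, sub_zero, Real.norm_eq_abs, Real.norm_eq_abs, abs_sub_comm,
    abs_of_nonneg (sub_nonneg.2 hs)] at h1
  rw [fderiv_modeFun_self hg hP, modeFun, abs_mul]
  calc _ ≤ L * (R ^ 2 - ‖x‖ ^ 2) * B :=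
        mul_le_mul h1 (hB x hx) (abs_nonneg _) ((abs_nonneg _).trans h1)
    _ = _ := by ring

lemma IsVeryWeakSolution.integral_modeFun_eq_zero {μ : ℝ} {u : E N → ℝ}
    (hu : IsVeryWeakSolution R μ u) {k : ℕ} {P : MvPolynomial (Fin N) ℝ} (hP : IsHarmonic k P)
    {g h : ℝ → ℝ} (hg : ContDiff ℝ ∞ g) (h0 : neumannTrace k g (R ^ 2) = 0)
    (hode : ∀ s, 4 * s * deriv (deriv g) s + (4 * (N / 2 + k) - 2 * s) * deriv g s
      - (k - μ) * g s = h s) :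
    ∫ x in ball 0 R, u x * modeFun h P x ∂(gauss N) = 0 := by
  rw [← hu.2 _ (isNeumannTest_modeFun hg hP.1 h0)]
  refine integral_congr_ae (Eventually.of_forall fun x => ?_)
  simp only [ouOp_modeFun hg hP.1 hP.2, modeFun, ← hode]
  ring

lemma neumannTrace_sub_const_mul {g f : ℝ → ℝ} (hg : ContDiff ℝ ∞ g) (hf : ContDiff ℝ ∞ f)
    (c : ℝ) (k : ℕ) (s : ℝ) : neumannTrace k (fun s => g s - c * f s) s
      = neumannTrace k g s - c * neumannTrace k f s := by
  have h : deriv (fun s => g s - c * f s) s = deriv g s - c * deriv f s :=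
    ((hasDerivAt_of_contDiff hg s).sub ((hasDerivAt_of_contDiff hf s).const_mul c)).deriv
  rw [neumannTrace, neumannTrace, neumannTrace, h]; ring

lemma sub_const_mul_ode {g f p q : ℝ → ℝ} (hg : ContDiff ℝ ∞ g) (hf : ContDiff ℝ ∞ f)
    {a b c : ℝ}
    (hgo : ∀ s, 4 * s * deriv (deriv g) s + (4 * b - 2 * s) * deriv g s - a * g s = p s)
    (hfo : ∀ s, 4 * s * deriv (deriv f) s + (4 * b - 2 * s) * deriv f s - a * f s = q s) (s : ℝ) :
    4 * s * deriv (deriv fun s => g s - c * f s) s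
      + (4 * b - 2 * s) * deriv (fun s => g s - c * f s) s - a * (g s - c * f s)
      = p s - c * q s := by
  have h : deriv (fun s => g s - c * f s) = fun s => deriv g s - c * deriv f s :=
    funext fun s =>
      ((hasDerivAt_of_contDiff hg s).sub ((hasDerivAt_of_contDiff hf s).const_mul c)).deriv
  have h' : deriv (fun s => deriv g s - c * deriv f s) s
      = deriv (deriv g) s - c * deriv (deriv f) s :=
    ((hasDerivAt_of_contDiff (contDiff_deriv hg) s).sub
      ((hasDerivAt_of_contDiff (contDiff_deriv hf) s).const_mul c)).deriv
  rw [h, h', ← hgo, ← hfo]; ring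

/-- Without resonance in mode `k`, a solution has no component of mode `k`. -/
lemma IsVeryWeakSolution.orthogonal_of_nonresonant (hN : 1 ≤ N) {μ : ℝ} {u : E N → ℝ}
    (hu : IsVeryWeakSolution R μ u) {k : ℕ} {P : MvPolynomial (Fin N) ℝ} (hP : IsHarmonic k P)
    (hres : neumannTrace k (profile N k μ) (R ^ 2) ≠ 0) (p : Polynomial ℝ) :
    ∫ x in ball 0 R, u x * modeFun (fun s => p.eval s) P x ∂(gauss N) = 0 := by
  obtain ⟨g, hg, hode⟩ := exists_kummer_inhomogeneous (k - μ) (half_le_add hN k) p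
  have hf := contDiff_profile hN k μ
  -- Subtracting `c` times the homogeneous solution enforces the Neumann condition without changing
  -- the right-hand side.
  set c := neumannTrace k g (R ^ 2) / neumannTrace k (profile N k μ) (R ^ 2) with hc
  refine hu.integral_modeFun_eq_zero hP (g := fun s => g s - c * profile N k μ s)
    (hg.sub (contDiff_const.mul hf)) ?_ fun s => ?_
  · rw [neumannTrace_sub_const_mul hg hf, hc, div_mul_cancel₀ _ hres, sub_self]
  · rw [sub_const_mul_ode hg hf hode (profile_ode hN k μ), mul_zero, sub_zero]

/-! ### Explicit eigenfunctions from resonances. -/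

lemma not_ae_eq_zero_of_continuous {f : E N → ℝ} (hf : Continuous f) {x : E N}
    (hx : x ∈ ball (0 : E N) R) (h : f x ≠ 0) :
    ¬ f =ᵐ[(gauss N).restrict (ball 0 R)] 0 := by
  intro h0
  have h1 : ∀ᵐ y ∂(volume : Measure (E N)).restrict (ball 0 R), f y = 0 :=
    (ae_restrict_gauss_iff measurableSet_ball).1 h0
  rw [ae_restrict_iff' measurableSet_ball] at h1
  have ho : IsOpen {y : E N | y ∈ ball (0 : E N) R ∧ f y ≠ 0} :=
    isOpen_ball.inter (isOpen_ne_fun hf continuous_const)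
  refine (ho.measure_pos (volume : Measure (E N)) ⟨x, hx, h⟩).ne' ?_
  have h2 := ae_iff.1 h1
  refine measure_mono_null ?_ h2
  rintro y ⟨hy, hy'⟩ h3
  exact hy' (h3 hy)

lemma isNeumannEigenfunction_modeFun (hR : 0 < R) {μ : ℝ} {k : ℕ} {P : MvPolynomial (Fin N) ℝ}
    (hP : IsHarmonic k P) {g : ℝ → ℝ} (hg : ContDiff ℝ ∞ g)
    (h0 : neumannTrace k g (R ^ 2) = 0)
    (hode : ∀ s, 4 * s * deriv (deriv g) s + (4 * (N / 2 + k) - 2 * s) * deriv g s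
      - (k - μ) * g s = 0) (hne : ¬ modeFun g P =ᵐ[(gauss N).restrict (ball 0 R)] 0) :
    IsNeumannEigenfunction (ball 0 R) μ (modeFun g P) := by
  obtain ⟨hs, C, hC⟩ := isNeumannTest_modeFun (R := R) hg hP.1 h0
  refine ⟨hne, _, memH1_of_contDiff hs, fun v H hv => ?_⟩
  simp only [inner_gradient_left]
  rw [hv.green hR hs hC, ← integral_neg, ← integral_const_mul]
  refine integral_congr_ae (Eventually.of_forall fun x => ?_)
  simp only
  have h1 : ouOp (modeFun g P) x = -μ * modeFun g P x := by
    rw [ouOp_modeFun hg hP.1 hP.2, modeFun]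
    linear_combination polyFun P x * hode (‖x‖ ^ 2)
  rw [h1]; ring

/-! ### Invariance under modification on null sets -/

lemma IsNeumannEigenfunction.congr {μ : ℝ} {u u' : E N → ℝ}
    (h : IsNeumannEigenfunction (ball 0 R) μ u) (huu : u =ᵐ[(gauss N).restrict (ball 0 R)] u') :
    IsNeumannEigenfunction (ball 0 R) μ u' := by
  obtain ⟨hne, G, ⟨⟨hl, hGl, hw⟩, h2, hG2⟩, heq⟩ := h
  have hv : u =ᵐ[(volume : Measure (E N)).restrict (ball 0 R)] u' :=
    (ae_restrict_gauss_iff measurableSet_ball).1 huu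
  refine ⟨fun h0 => hne (huu.trans h0), G,
    ⟨⟨?_, hGl, fun φ h1 h2 h3 e => ?_⟩, (memLp_congr_ae huu).1 h2, hG2⟩, fun v H hvH => ?_⟩
  · rw [locallyIntegrableOn_iff isOpen_ball.isLocallyClosed] at hl ⊢
    intro K hK hKc
    exact (hl K hK hKc).congr (hv.filter_mono (ae_mono (Measure.restrict_mono hK le_rfl)))
  · rw [← hw φ h1 h2 h3 e]
    exact integral_congr_ae (by filter_upwards [hv] with x hx; rw [hx])
  · rw [heq v H hvH]
    congr 1
    exact integral_congr_ae (by filter_upwards [huu] with x hx; rw [hx])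

/-! ### Polar coordinates -/

/-- Spherical measure times radial measure. -/
noncomputable def polarMeasure (N : ℕ) : Measure (sphere (0 : E N) 1 × Ioi (0 : ℝ)) :=
  (volume : Measure (E N)).toSphere.prod (Measure.volumeIoiPow (Module.finrank ℝ (E N) - 1))

/-- The map `x ↦ (x / |x|, |x|)`. -/
noncomputable def toPolar (N : ℕ) : ({0}ᶜ : Set (E N)) ≃ₜ sphere (0 : E N) 1 × Ioi (0 : ℝ) :=
  homeomorphUnitSphereProd (E N)

lemma measurePreserving_toPolar :
    MeasurePreserving (toPolar N) ((volume : Measure (E N)).comap (↑)) (polarMeasure N) :=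
  (volume : Measure (E N)).measurePreserving_homeomorphUnitSphereProd

lemma toPolar_fst (x : ({0}ᶜ : Set (E N))) : ((toPolar N x).1 : E N) = ‖(x : E N)‖⁻¹ • (x : E N) := by
  simp [toPolar]

lemma toPolar_snd (x : ({0}ᶜ : Set (E N))) : ((toPolar N x).2 : ℝ) = ‖(x : E N)‖ := by
  simp [toPolar]

lemma restrict_compl_zero (hN : 1 ≤ N) :
    (volume : Measure (E N)).restrict {0}ᶜ = volume := by
  have : Nonempty (Fin N) := ⟨⟨0, hN⟩⟩
  exact restrict_compl_singleton 0

lemma integral_polar (hN : 1 ≤ N) {W : E N → ℝ} {w : sphere (0 : E N) 1 × Ioi (0 : ℝ) → ℝ}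
    (h : ∀ x : ({0}ᶜ : Set (E N)), W x = w (toPolar N x)) :
    ∫ x, W x = ∫ q, w q ∂(polarMeasure N) := by
  rw [← measurePreserving_toPolar.integral_comp (toPolar N).measurableEmbedding,
    ← restrict_compl_zero hN, ← integral_subtype_comap (measurableSet_singleton _).compl W,
    restrict_compl_zero hN]
  simp only [h]

lemma integrable_polar (hN : 1 ≤ N) {W : E N → ℝ} {w : sphere (0 : E N) 1 × Ioi (0 : ℝ) → ℝ}
    (h : ∀ x : ({0}ᶜ : Set (E N)), W x = w (toPolar N x)) (hW : Integrable W) :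
    Integrable w (polarMeasure N) := by
  rw [← measurePreserving_toPolar.integrable_comp_emb (toPolar N).measurableEmbedding]
  rw [← restrict_compl_zero hN, ← IntegrableOn,
    integrableOn_iff_comap_subtypeVal (measurableSet_singleton _).compl] at hW
  exact hW.congr (Eventually.of_forall h)

lemma ae_eq_zero_polar (hN : 1 ≤ N) {W : E N → ℝ} {w : sphere (0 : E N) 1 × Ioi (0 : ℝ) → ℝ}
    (h : ∀ x : ({0}ᶜ : Set (E N)), W x = w (toPolar N x))
    (hw : ∀ᵐ q ∂(polarMeasure N), w q = 0) : ∀ᵐ x : E N, W x = 0 := by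
  have h1 : ∀ᵐ x : ({0}ᶜ : Set (E N)) ∂((volume : Measure (E N)).comap (↑)), W x = 0 := by
    filter_upwards [measurePreserving_toPolar.quasiMeasurePreserving.ae hw] with x hx
    rw [h, hx]
  rw [← restrict_compl_zero hN]
  exact (ae_restrict_iff_subtype (measurableSet_singleton _).compl).2 h1

lemma polyFun_smul_of_isHomogeneous {P : MvPolynomial (Fin N) ℝ} {k : ℕ} (hP : P.IsHomogeneous k)
    (c : ℝ) (x : E N) : polyFun P (c • x) = c ^ k * polyFun P x := by
  rw [polyFun, polyFun, eval_eq', eval_eq', Finset.mul_sum]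
  refine Finset.sum_congr rfl fun d hd => ?_
  have h1 : ∑ i, d i = k := by
    have := hP (mem_support_iff.1 hd)
    rw [Finsupp.weight_apply, Finsupp.sum_fintype _ _ (by simp)] at this
    exact (Finset.sum_congr rfl fun i _ => by simp).trans this
  simp only [PiLp.smul_apply, smul_eq_mul, mul_pow, Finset.prod_mul_distrib,
    Finset.prod_pow_eq_pow_sum, h1]
  ring

lemma polarProduct_eq {P : MvPolynomial (Fin N) ℝ} {Y : E N → ℝ}
    (hY : ∀ θ ∈ sphere (0 : E N) 1, Y θ = polyFun P θ) (f : ℝ → ℝ) (x : ({0}ᶜ : Set (E N))) :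
    polarProduct f Y (x : E N) = f (toPolar N x).2 * polyFun P (toPolar N x).1 := by
  rw [polarProduct, ← hY _ (toPolar N x).1.2, toPolar_fst, toPolar_snd]

/-- A function `f (|x|) Y (x / |x|)` orthogonal to all `p (|x| ^ 2) P`, where `P = Y` on the sphere,
vanishes. -/
lemma polarProduct_ae_eq_zero (hN : 1 ≤ N) {k : ℕ} {P : MvPolynomial (Fin N) ℝ}
    (hP : P.IsHomogeneous k) {Y : E N → ℝ} (hY : ∀ θ ∈ sphere (0 : E N) 1, Y θ = polyFun P θ)
    {f : ℝ → ℝ} (hu : Integrable (polarProduct f Y) ((gauss N).restrict (ball 0 R)))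
    (h : ∀ p : Polynomial ℝ, ∫ x in ball 0 R,
      polarProduct f Y x * modeFun (fun s => p.eval s) P x ∂(gauss N) = 0) :
    polarProduct f Y =ᵐ[(gauss N).restrict (ball 0 R)] 0 := by
  -- Absorbing the density and the restriction to the ball into the radial factor leaves a pure
  -- product in polar coordinates.
  set φ : ℝ → ℝ := (Iio R).indicator fun r =>
    (2 * Real.pi) ^ (-(N : ℝ) / 2) * Real.exp (-r ^ 2 / 2) * f r with hφ
  have hφx : ∀ x : ({0}ᶜ : Set (E N)), (ball (0 : E N) R).indicator
      (fun x => gaussDensity N x * polarProduct f Y x) (x : E N)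
      = φ (toPolar N x).2 * polyFun P (toPolar N x).1 := by
    intro x
    classical
    rw [indicator_apply, hφ, indicator_apply, polarProduct_eq hY]
    simp only [mem_ball_zero_iff, toPolar_snd, mem_Iio, gaussDensity]
    split_ifs <;> ring
  have hqc : Continuous fun θ : sphere (0 : E N) 1 => polyFun P θ :=
    (contDiff_polyFun P).continuous.comp continuous_subtype_val
  suffices hs : ∀ᵐ q ∂(polarMeasure N), φ q.2 * polyFun P q.1 = 0 by
    have h1 := ae_eq_zero_polar hN hφx hs
    rw [EventuallyEq, ae_restrict_gauss_iff measurableSet_ball,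
      ae_restrict_iff' measurableSet_ball]
    filter_upwards [h1] with x hx hxB
    rw [indicator_of_mem hxB] at hx
    exact (mul_eq_zero.1 hx).resolve_left (gaussDensity_pos x).ne'
  set σ := (volume : Measure (E N)).toSphere with hσ
  set ν := Measure.volumeIoiPow (Module.finrank ℝ (E N) - 1) with hν
  have hsq : Integrable (fun θ : sphere (0 : E N) 1 => polyFun P θ ^ 2) σ :=
    (hqc.pow 2).integrable_of_hasCompactSupport (HasCompactSupport.of_compactSpace _)
  by_cases hI : ∫ θ : sphere (0 : E N) 1, polyFun P θ ^ 2 ∂σ = 0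
  · rw [integral_eq_zero_iff_of_nonneg (fun θ => sq_nonneg _) hsq] at hI
    have h1 : ∀ᵐ q ∂(polarMeasure N), polyFun P q.1 ^ 2 = 0 :=
      Measure.quasiMeasurePreserving_fst.ae hI
    filter_upwards [h1] with q hq
    rw [pow_eq_zero_iff two_ne_zero] at hq
    rw [hq, mul_zero]
  have hint : Integrable (fun q : sphere (0 : E N) 1 × Ioi (0 : ℝ) => φ q.2 * polyFun P q.1)
      (polarMeasure N) := by
    refine integrable_polar hN hφx ?_
    rw [integrable_indicator_iff measurableSet_ball]
    rw [gauss, restrict_withDensity measurableSet_ball,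
      integrable_withDensity_iff_integrable_smul' measurable_ofReal_gaussDensity
        (Eventually.of_forall fun _ => ENNReal.ofReal_lt_top)] at hu
    simpa [IntegrableOn, ENNReal.toReal_ofReal (gaussDensity_pos _).le] using hu
  -- No regularity of `f` is assumed; integrability comes from Fubini on a slice where `P θ ≠ 0`.
  have hφi : Integrable (fun r : Ioi (0 : ℝ) => φ r) ν := by
    have h1 := hint.prod_right_ae
    have h2 : ∃ᶠ θ : sphere (0 : E N) 1 in ae σ, polyFun P θ ≠ 0 := by
      intro h3
      apply hI
      rw [integral_eq_zero_iff_of_nonneg (fun θ => sq_nonneg _) hsq]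
      filter_upwards [h3] with θ hθ
      simpa using hθ
    obtain ⟨θ, h2, h1⟩ := (h2.and_eventually h1).exists
    exact (integrable_mul_const_iff (isUnit_iff_ne_zero.2 h2) _).1 h1
  have hz : ∀ p : Polynomial ℝ,
      ∫ r : Ioi (0 : ℝ), φ r * (r : ℝ) ^ k * p.eval ((r : ℝ) ^ 2) ∂ν = 0 := by
    intro p
    have h1 := h p
    rw [setIntegral_gauss _ measurableSet_ball, ← integral_indicator measurableSet_ball,
      integral_polar hN (w := fun q => polyFun P q.1 ^ 2 *
        (φ q.2 * (q.2 : ℝ) ^ k * p.eval ((q.2 : ℝ) ^ 2)))] at h1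
    · rw [polarMeasure, integral_prod_mul (fun θ : sphere (0 : E N) 1 => polyFun P θ ^ 2)
        (fun r : Ioi (0 : ℝ) => φ r * (r : ℝ) ^ k * p.eval ((r : ℝ) ^ 2))] at h1
      exact (mul_eq_zero.1 h1).resolve_left hI
    · intro x
      have h2 := hφx x
      have h3 : polyFun P (x : E N) = ‖(x : E N)‖ ^ k * polyFun P (toPolar N x).1 := by
        rw [← polyFun_smul_of_isHomogeneous hP, toPolar_fst, smul_smul,
          mul_inv_cancel₀ (norm_ne_zero_iff.2 x.2), one_smul]
      have h4 : (ball (0 : E N) R).indicator (fun x => gaussDensity N x *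
          (polarProduct f Y x * modeFun (fun s => p.eval s) P x)) (x : E N)
          = (ball (0 : E N) R).indicator (fun x => gaussDensity N x * polarProduct f Y x) (x : E N)
            * modeFun (fun s => p.eval s) P x := by
        classical
        rw [indicator_apply, indicator_apply]; split_ifs <;> ring
      rw [h4, h2, modeFun, h3, toPolar_snd]
      ring
  have hme : MeasurableEmbedding ((↑) : Ioi (0 : ℝ) → ℝ) :=
    MeasurableEmbedding.subtype_coe measurableSet_Ioi
  set ν' := (ν.map ((↑) : Ioi (0 : ℝ) → ℝ)).restrict (Iio R) with hν'
  have hsupp : ∀ r ∉ Iio R, φ r = 0 := fun r hr => indicator_of_notMem hr _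
  have hφ' : Integrable φ ν' := ((hme.integrable_map_iff (g := φ)).2 hφi).restrict
  have hK : ∀ᵐ r ∂ν', r ∈ Icc 0 R := by
    rw [ae_restrict_iff' measurableSet_Iio, hme.ae_map_iff]
    exact Eventually.of_forall fun r hr => ⟨r.2.le, hr.le⟩
  have hfin : ∀ᵐ r ∂ν', φ r * r ^ k = 0 := by
    refine ae_eq_zero_of_uniform_approx (K := Icc 0 R) ?_ hK
      (range fun (p : Polynomial ℝ) (r : ℝ) => p.eval (r ^ 2)) ?_ ?_
    · refine hφ'.mul_bdd (c := R ^ k) (continuous_pow k).aestronglyMeasurable ?_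
      filter_upwards [hK] with r hr
      rw [norm_pow, Real.norm_eq_abs, abs_of_nonneg hr.1]
      exact pow_le_pow_left₀ hr.1 hr.2 k
    · rintro _ ⟨p, rfl⟩
      refine ⟨p.continuous.comp (continuous_pow 2), ?_⟩
      rw [← hz p, setIntegral_eq_integral_of_forall_compl_eq_zero, hme.integral_map]
      intro r hr
      rw [hsupp r hr]; simp
    · intro g hg ε hε
      -- Polynomials in `r ^ 2` suffice on `[0, R]`: apply Weierstrass to `g ∘ √`.
      obtain ⟨p, hp⟩ := exists_polynomial_near_of_continuousOn 0 (R ^ 2) (fun s => g (√s))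
        (hg.comp Real.continuous_sqrt).continuousOn ε hε
      refine ⟨_, ⟨p, rfl⟩, fun r hr => ?_⟩
      have := hp (r ^ 2) (sq_mem_Icc hr)
      rw [Real.sqrt_sq hr.1] at this
      exact this.le
  rw [ae_restrict_iff' measurableSet_Iio, hme.ae_map_iff] at hfin
  have h1 : ∀ᵐ q ∂(polarMeasure N), (q.2 : ℝ) ∈ Iio R → φ q.2 * (q.2 : ℝ) ^ k = 0 :=
    Measure.quasiMeasurePreserving_snd.ae hfin
  filter_upwards [h1] with q hq
  by_cases hqR : (q.2 : ℝ) ∈ Iio R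
  · rw [(mul_eq_zero.1 (hq hqR)).resolve_right (pow_pos q.2.2 k).ne', zero_mul]
  · rw [hsupp _ hqR, zero_mul]

/-! ### The eigenspace of the first eigenvalue -/

/-- The reflection in the `i`-th coordinate preserves the ball and the density and changes the sign
of the integrand. -/
lemma integral_modeFun_X_mul_X_of_ne (g : ℝ → ℝ) {i j : Fin N} (hij : i ≠ j) :
    ∫ x in ball 0 R, modeFun g (X i * X j) x ∂(gauss N) = 0 := by
  classical
  let e : E N ≃ₗᵢ[ℝ] E N := LinearIsometryEquiv.piLpCongrRight 2 fun l =>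
    if l = i then LinearIsometryEquiv.neg ℝ else LinearIsometryEquiv.refl ℝ ℝ
  have hei : ∀ x : E N, e x i = -x i := fun x => by simp [e]
  have hej : ∀ x : E N, e x j = x j := fun x => by simp [e, hij.symm]
  rw [setIntegral_gauss _ measurableSet_ball, ← integral_indicator measurableSet_ball]
  set W : E N → ℝ := (ball (0 : E N) R).indicator
    fun x => gaussDensity N x * modeFun g (X i * X j) x with hW
  have hodd : ∀ x, W (e x) = -W x := by
    intro x
    simp only [hW, indicator_apply, mem_ball_zero_iff, LinearIsometryEquiv.norm_map, modeFun,
      gaussDensity, polyFun_mul, polyFun_X, hei, hej]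
    split_ifs <;> ring
  have h1 := e.measurePreserving.integral_comp e.toHomeomorph.measurableEmbedding W
  simp only [hodd, integral_neg] at h1
  linarith

lemma isHarmonic_X (i : Fin N) : IsHarmonic 1 (X i : MvPolynomial (Fin N) ℝ) := by
  classical
  refine ⟨isHomogeneous_X ℝ i, ?_⟩
  rw [lap_apply]
  refine Finset.sum_eq_zero fun j _ => ?_
  rw [pderiv_X]
  by_cases h : i = j
  · subst h; simp
  · simp [h]

lemma isHarmonic_sum_smul_X (c : Fin N → ℝ) :
    IsHarmonic 1 (∑ i, c i • (X i : MvPolynomial (Fin N) ℝ)) := by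
  refine ⟨?_, ?_⟩
  · rw [← mem_homogeneousSubmodule]
    exact Submodule.sum_mem _ fun i _ => Submodule.smul_mem _ _ (isHarmonic_X i).1
  · rw [map_sum]
    exact Finset.sum_eq_zero fun i _ => by rw [map_smul, (isHarmonic_X i).2, smul_zero]

lemma exists_eq_sum_smul_X {P : MvPolynomial (Fin N) ℝ} (hP : P.IsHomogeneous 1) :
    ∃ c : Fin N → ℝ, P = ∑ i, c i • X i := by
  rw [← mem_homogeneousSubmodule, homogeneousSubmodule_one_eq_span_X,
    Submodule.mem_span_range_iff_exists_fun] at hP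
  obtain ⟨c, hc⟩ := hP
  exact ⟨c, hc.symm⟩

lemma polyFun_sum_smul_X (c : Fin N → ℝ) (x : E N) :
    polyFun (∑ i, c i • (X i : MvPolynomial (Fin N) ℝ)) x = ∑ i, c i * x i := by
  simp only [polyFun_sum, polyFun_smul, polyFun_X]

lemma isVeryWeakSolution_modeFun (hR : 0 < R) {μ : ℝ} {k : ℕ} {P : MvPolynomial (Fin N) ℝ}
    (hP : IsHarmonic k P) {g : ℝ → ℝ} (hg : ContDiff ℝ ∞ g)
    (h0 : neumannTrace k g (R ^ 2) = 0)
    (hode : ∀ s, 4 * s * deriv (deriv g) s + (4 * (N / 2 + k) - 2 * s) * deriv g s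
      - (k - μ) * g s = 0) : IsVeryWeakSolution R μ (modeFun g P) := by
  by_cases hne : modeFun g P =ᵐ[(gauss N).restrict (ball 0 R)] 0
  · refine ⟨integrable_of_continuous (contDiff_modeFun hg P).continuous, fun v _ => ?_⟩
    refine integral_eq_zero_of_ae ?_
    filter_upwards [hne] with x hx
    rw [hx]; simp
  · exact (isNeumannEigenfunction_modeFun hR hP hg h0 hode hne).isVeryWeakSolution hR

lemma half_single_mem (hR : 0 < R) {θ : E N} (hθ : θ ∈ sphere (0 : E N) 1) :
    (R / 2) • θ ∈ ball (0 : E N) R := by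
  rw [mem_ball_zero_iff, norm_smul, mem_sphere_zero_iff_norm.1 hθ, Real.norm_eq_abs,
    abs_of_pos (by linarith)]
  linarith

lemma single_mem_sphere (i : Fin N) : EuclideanSpace.single i (1 : ℝ) ∈ sphere (0 : E N) 1 := by
  simp

lemma modeFun_half_ne_zero (hR : 0 < R) {g : ℝ → ℝ} (hpos : ∀ s ∈ Icc 0 (R ^ 2), 0 < g s)
    {k : ℕ} {P : MvPolynomial (Fin N) ℝ} (hP : P.IsHomogeneous k) {θ : E N}
    (hθ : θ ∈ sphere (0 : E N) 1) (h : polyFun P θ ≠ 0) :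
    modeFun g P ((R / 2) • θ) ≠ 0 := by
  have h1 : ‖(R / 2) • θ‖ ≤ R := (mem_ball_zero_iff.1 (half_single_mem hR hθ)).le
  rw [modeFun, polyFun_smul_of_isHomogeneous hP]
  exact mul_ne_zero (hpos _ (sq_mem_Icc ⟨norm_nonneg _, h1⟩)).ne'
    (mul_ne_zero (pow_ne_zero _ (by positivity)) h)

lemma integral_modeFun_X_mul_X_pos (hR : 0 < R) {g : ℝ → ℝ} (hg : ContDiff ℝ ∞ g)
    (hpos : ∀ s ∈ Icc 0 (R ^ 2), 0 < g s) (i : Fin N) :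
    0 < ∫ x in ball 0 R, modeFun g (X i * X i) x ∂(gauss N) := by
  have hnn : 0 ≤ᵐ[(gauss N).restrict (ball 0 R)] modeFun g (X i * X i) := by
    filter_upwards [ae_restrict_mem measurableSet_ball] with x hx
    rw [modeFun, polyFun_mul]
    exact mul_nonneg (hpos _ (sq_mem_Icc ⟨norm_nonneg _, (mem_ball_zero_iff.1 hx).le⟩)).le
      (mul_self_nonneg _)
  refine lt_of_le_of_ne (integral_nonneg_of_ae hnn) fun h => ?_
  have hc := (contDiff_modeFun hg (X i * X i : MvPolynomial (Fin N) ℝ)).continuous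
  refine not_ae_eq_zero_of_continuous hc (half_single_mem hR (single_mem_sphere i))
    (modeFun_half_ne_zero hR hpos ((isHomogeneous_X ℝ i).mul (isHomogeneous_X ℝ i))
      (single_mem_sphere i) ?_)
    ((integral_eq_zero_iff_of_nonneg_ae hnn (integrable_of_continuous hc)).1 h.symm)
  simp [polyFun_mul, polyFun_X]

/-- If all modes but the first are non-resonant, and the profile of mode one satisfies the Neumann
condition, then every solution is a multiple of that profile by a linear form. -/
lemma IsVeryWeakSolution.ae_eq_modeFun (hN : 1 ≤ N) (hR : 0 < R) {ν : ℝ} {u : E N → ℝ}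
    (hu : IsVeryWeakSolution R ν u) (hpos : ∀ s ∈ Icc 0 (R ^ 2), 0 < profile N 1 ν s)
    (hz : neumannTrace 1 (profile N 1 ν) (R ^ 2) = 0)
    (hres : ∀ k, k ≠ 1 → neumannTrace k (profile N k ν) (R ^ 2) ≠ 0) :
    ∃ c : Fin N → ℝ,
      u =ᵐ[(gauss N).restrict (ball 0 R)] modeFun (profile N 1 ν) (∑ i, c i • X i) := by
  set g := profile N 1 ν with hg
  have hgs : ContDiff ℝ ∞ g := contDiff_profile hN 1 ν
  have hgo := profile_ode hN 1 ν
  rw [← hg] at hgo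
  set I : Fin N → ℝ := fun i => ∫ x in ball 0 R, modeFun g (X i * X i) x ∂(gauss N) with hI
  have hIpos : ∀ i, 0 < I i := integral_modeFun_X_mul_X_pos hR hgs hpos
  -- The Gram matrix of the `g(|x| ^ 2) x_i` against the `x_j` is diagonal with positive entries `I
  -- i`, so these coefficients make the difference orthogonal to all linear forms.
  set c : Fin N → ℝ := fun i => (∫ x in ball 0 R, u x * x i ∂(gauss N)) / I i with hc
  set P₀ : MvPolynomial (Fin N) ℝ := ∑ i, c i • X i with hP₀
  have hsol := fun {P : MvPolynomial (Fin N) ℝ} (hP : IsHarmonic 1 P) =>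
    isVeryWeakSolution_modeFun hR hP hgs hz hgo
  have hu' := hu.sub (hsol (isHarmonic_sum_smul_X c))
  refine ⟨c, ?_⟩
  suffices h : (fun x => u x - modeFun g P₀ x) =ᵐ[(gauss N).restrict (ball 0 R)] 0 by
    filter_upwards [h] with x hx
    exact sub_eq_zero.1 hx
  have hmul := fun (Q : MvPolynomial (Fin N) ℝ) =>
    GaussNeumann.Integrable.mul_continuous hu'.1 (contDiff_polyFun Q).continuous
  have horthX : ∀ j, ∫ x in ball 0 R, (u x - modeFun g P₀ x) * polyFun (X j) x ∂(gauss N) = 0 := by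
    intro j
    have h1 : ∀ x : E N, (u x - modeFun g P₀ x) * polyFun (X j) x
        = u x * x j - ∑ i, c i * modeFun g (X i * X j) x := by
      intro x
      rw [sub_mul, modeFun, hP₀, polyFun_sum_smul_X, polyFun_X, Finset.mul_sum, Finset.sum_mul]
      congr 1
      exact Finset.sum_congr rfl fun i _ => by rw [modeFun, polyFun_mul, polyFun_X, polyFun_X]; ring
    have i1 : Integrable (fun x => u x * x j) ((gauss N).restrict (ball 0 R)) :=
      GaussNeumann.Integrable.mul_continuous hu.1 (by fun_prop : Continuous fun x : E N => x j)
    have i2 : ∀ i, Integrable (fun x => c i * modeFun g (X i * X j) x)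
        ((gauss N).restrict (ball 0 R)) := fun i =>
      (integrable_of_continuous (contDiff_modeFun hgs _).continuous).const_mul _
    simp only [h1]
    rw [integral_sub i1 (integrable_finsetSum _ fun i _ => i2 i),
      integral_finsetSum _ fun i _ => i2 i, Finset.sum_eq_single j]
    · rw [integral_const_mul, hc]
      simp only
      rw [div_mul_cancel₀ _ (hIpos j).ne', sub_self]
    · intro i _ hij
      rw [integral_const_mul, integral_modeFun_X_mul_X_of_ne g hij, mul_zero]
    · simp
  have horth1 : ∀ P, IsHarmonic 1 P →
      ∫ x in ball 0 R, (u x - modeFun g P₀ x) * polyFun P x ∂(gauss N) = 0 := by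
    intro P hP
    obtain ⟨a, rfl⟩ := exists_eq_sum_smul_X hP.1
    have h1 : ∀ x : E N, (u x - modeFun g P₀ x) * polyFun (∑ i, a i • X i) x
        = ∑ i, a i * ((u x - modeFun g P₀ x) * polyFun (X i) x) := by
      intro x
      rw [polyFun_sum, Finset.mul_sum]
      exact Finset.sum_congr rfl fun i _ => by rw [polyFun_smul]; ring
    simp only [h1]
    rw [integral_finsetSum _ fun i _ => (hmul (X i)).const_mul (a i)]
    exact Finset.sum_eq_zero fun i _ => by rw [integral_const_mul, horthX, mul_zero]
  refine ae_eq_zero_of_orthogonal_harmonic hN hu'.1 fun k P hP p => ?_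
  by_cases hk : k = 1
  swap
  · exact hu'.orthogonal_of_nonresonant hN hP (hres k hk) p
  subst hk
  obtain ⟨f, hf, hfo⟩ := exists_kummer_inhomogeneous ((1 : ℕ) - ν) (half_le_add hN 1) p
  obtain ⟨f₁, hf₁, hfo₁⟩ := exists_kummer_inhomogeneous ((1 : ℕ) - ν) (half_le_add hN 1) 1
  -- In resonance the profile cannot correct the trace, so the solution `f₁` with right-hand side
  -- `1` does. Were its trace zero, the eigenfunction `g(|x| ^ 2) x_i` would be orthogonal to `x_i`,
  -- against `I i > 0`. This gives orthogonality to `p - d`, and the constant part is covered by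
  -- `horth1`.
  have hne : neumannTrace 1 f₁ (R ^ 2) ≠ 0 := by
    intro h0
    have h1 := (hsol (isHarmonic_X ⟨0, hN⟩)).integral_modeFun_eq_zero (isHarmonic_X ⟨0, hN⟩)
      hf₁ h0 hfo₁
    refine (hIpos ⟨0, hN⟩).ne' (Eq.trans ?_ h1)
    refine integral_congr_ae (Eventually.of_forall fun x => ?_)
    simp only [modeFun, polyFun_mul, Polynomial.eval_one]
    ring
  set d := neumannTrace 1 f (R ^ 2) / neumannTrace 1 f₁ (R ^ 2) with hd
  have h2 := hu'.integral_modeFun_eq_zero hP (g := fun s => f s - d * f₁ s)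
    (h := fun s => p.eval s - d * (1 : Polynomial ℝ).eval s)
    (hf.sub (contDiff_const.mul hf₁))
    (by rw [neumannTrace_sub_const_mul hf hf₁, hd, div_mul_cancel₀ _ hne, sub_self])
    (sub_const_mul_ode hf hf₁ hfo hfo₁)
  have i1 : Integrable (fun x => (u x - modeFun g P₀ x) * modeFun (fun s => p.eval s) P x)
      ((gauss N).restrict (ball 0 R)) :=
    GaussNeumann.Integrable.mul_continuous hu'.1
      ((p.continuous.comp (continuous_norm.pow 2)).mul (contDiff_polyFun P).continuous)
  have h3 : ∀ x : E N, (u x - modeFun g P₀ x) *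
      modeFun (fun s => p.eval s - d * (1 : Polynomial ℝ).eval s) P x
      = (u x - modeFun g P₀ x) * modeFun (fun s => p.eval s) P x
        - d * ((u x - modeFun g P₀ x) * polyFun P x) := by
    intro x
    simp only [modeFun, Polynomial.eval_one]; ring
  have h2 := (integral_congr_ae (Eventually.of_forall h3)).symm.trans h2
  rw [integral_sub i1 ((hmul P).const_mul d), integral_const_mul, horth1 P hP, mul_zero,
    sub_zero] at h2
  exact h2

/-! ### Spherical harmonics -/

lemma IsSphericalHarmonic.exists_isHarmonic {k : ℕ} {Y : E N → ℝ} (hY : IsSphericalHarmonic k Y) :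
    ∃ P, IsHarmonic k P ∧ ∀ θ ∈ sphere (0 : E N) 1, Y θ = polyFun P θ := by
  obtain ⟨P, h1, h2, h3⟩ := hY
  exact ⟨P, ⟨h1, by rw [lap_apply, h2]⟩, h3⟩

lemma isSphericalHarmonic_polyFun {k : ℕ} {P : MvPolynomial (Fin N) ℝ} (hP : IsHarmonic k P) :
    IsSphericalHarmonic k (polyFun P) :=
  ⟨P, hP.1, by rw [← lap_apply, hP.2], fun _ _ => rfl⟩

lemma polarProduct_mul_eq_modeFun {P : MvPolynomial (Fin N) ℝ} (hP : P.IsHomogeneous 1)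
    {Y : E N → ℝ} (hY : ∀ θ ∈ sphere (0 : E N) 1, Y θ = polyFun P θ) (g : ℝ → ℝ) :
    polarProduct (fun r => r * g (r ^ 2)) Y = modeFun g P := by
  ext x
  rw [polarProduct, modeFun]
  rcases eq_or_ne x 0 with rfl | hx
  · have : polyFun P (0 : E N) = 0 := by
      simpa using polyFun_smul_of_isHomogeneous hP 0 (0 : E N)
    simp [this]
  · have hx' : ‖x‖ ≠ 0 := norm_ne_zero_iff.2 hx
    rw [hY _ (by rw [mem_sphere_zero_iff_norm, norm_smul, norm_inv, norm_norm,
      inv_mul_cancel₀ hx']), polyFun_smul_of_isHomogeneous hP]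
    field_simp

/-- Other modes may be resonant at `μ`, for instance mode `0` at `μ = 0`. For a separated function
nonresonance of its own mode is enough. -/
lemma IsVeryWeakSolution.polarProduct_ae_eq_zero (hN : 1 ≤ N) {μ : ℝ} {f : ℝ → ℝ} {Y : E N → ℝ}
    (hu : IsVeryWeakSolution R μ (polarProduct f Y)) {k : ℕ} (hY : IsSphericalHarmonic k Y)
    (hres : neumannTrace k (profile N k μ) (R ^ 2) ≠ 0) :
    polarProduct f Y =ᵐ[(gauss N).restrict (ball 0 R)] 0 := by
  obtain ⟨P, hP, hYP⟩ := hY.exists_isHarmonic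
  exact GaussNeumann.polarProduct_ae_eq_zero hN hP.1 hYP hu.1
    fun p => hu.orthogonal_of_nonresonant hN hP hres p

lemma isHarmonic_one : IsHarmonic 0 (1 : MvPolynomial (Fin N) ℝ) :=
  ⟨isHomogeneous_one _ _, by rw [lap_apply]; simp⟩

end GaussNeumann

/-! ### The main theorem. -/

theorem lemma4p1 (N : ℕ) (hN : 1 ≤ N) (R : ℝ) (hR : 0 < R) :
    ∃ ν₁ τ₁ : ℝ,
      IsLeast (GaussNeumann.nonradialEigenvalues N R) ν₁ ∧
      IsLeast (GaussNeumann.modeEigenvalues N R 1) ν₁ ∧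
      IsLeast {τ | τ ∈ GaussNeumann.radialEigenvalues N R ∧ τ ≠ 0} τ₁ ∧
      ν₁ < τ₁ ∧
      IsLeast {μ | μ ∈ GaussNeumann.eigenvalues N R ∧ μ ≠ 0} ν₁ ∧
      ∃ w : ℝ → ℝ,
        ContDiffOn ℝ 2 w (Icc 0 R) ∧
        w 0 = 0 ∧ derivWithin w (Icc 0 R) R = 0 ∧
        (∀ r ∈ Ioo 0 R,
          deriv (deriv w) r + deriv w r * (((N : ℝ) - 1) / r - r) + ν₁ * w r
            - ((N : ℝ) - 1) / r ^ 2 * w r = 0) ∧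
        (∀ r ∈ Ioc 0 R, 0 < w r) ∧
        MonotoneOn w (Icc 0 R) ∧
        ∀ u : GaussNeumann.E N → ℝ,
          GaussNeumann.IsNeumannEigenfunction (ball 0 R) ν₁ u ↔
            ∃ Y : GaussNeumann.E N → ℝ,
              GaussNeumann.IsSphericalHarmonic 1 Y ∧
              (∃ θ ∈ sphere (0 : GaussNeumann.E N) 1, Y θ ≠ 0) ∧
              u =ᵐ[(GaussNeumann.gauss N).restrict (ball 0 R)]
                GaussNeumann.polarProduct w Y := by
  open GaussNeumann MvPolynomial in
  obtain ⟨ν, τ, hν1, hντ, hpos, hnn, hz, hzτ, hres1, hres2, hres0⟩ :=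
    exists_neumann_parameters hN hR
  set g := profile N 1 ν with hg
  have hgs : ContDiff ℝ ∞ g := contDiff_profile hN 1 ν
  have hgo := profile_ode hN 1 ν
  rw [← hg] at hgo
  have hν0 : ν ≠ 0 := by linarith
  have hresν : ∀ k, k ≠ 1 → neumannTrace k (profile N k ν) (R ^ 2) ≠ 0 := by
    intro k hk
    rcases Nat.lt_or_ge k 2 with h | h
    · obtain rfl : k = 0 := by omega
      exact hres0 ν hντ hν0
    · exact hres2 k h ν le_rfl
  have heig : ∀ (P : MvPolynomial (Fin N) ℝ) (Y : E N → ℝ), IsHarmonic 1 P →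
      (∀ θ ∈ sphere (0 : E N) 1, Y θ = polyFun P θ) → (∃ θ ∈ sphere (0 : E N) 1, Y θ ≠ 0) →
      IsNeumannEigenfunction (ball 0 R) ν (polarProduct (fun r => r * g (r ^ 2)) Y) := by
    rintro P Y hP hYP ⟨θ, hθ, h⟩
    rw [polarProduct_mul_eq_modeFun hP.1 hYP]
    refine isNeumannEigenfunction_modeFun hR hP hgs hz hgo ?_
    exact not_ae_eq_zero_of_continuous (contDiff_modeFun hgs P).continuous (half_single_mem hR hθ)
      (modeFun_half_ne_zero hR hpos hP.1 hθ (by rwa [← hYP θ hθ]))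
  have hmem : ν ∈ modeEigenvalues N R 1 := by
    refine ⟨_, polyFun (X ⟨0, hN⟩), isSphericalHarmonic_polyFun (isHarmonic_X _),
      heig (X ⟨0, hN⟩) _ (isHarmonic_X _) (fun _ _ => rfl) ⟨_, single_mem_sphere ⟨0, hN⟩, ?_⟩⟩
    simp [polyFun_X]
  have hlow : ν ∈ lowerBounds (nonradialEigenvalues N R) := by
    rintro μ ⟨k, hk, f, Y, hY, hu⟩
    by_contra hμ
    exact hu.1 ((hu.isVeryWeakSolution hR).polarProduct_ae_eq_zero hN hY
      (hres1 k hk μ (not_le.1 hμ)))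
  have hd : ∀ r, HasDerivAt (fun r => r * g (r ^ 2)) (neumannTrace 1 g (r ^ 2)) r := by
    intro r; simpa using hasDerivAt_pow_mul hgs 0 r
  obtain ⟨hmono, -⟩ := monotone_and_pos hgs (by rw [hg, profile_zero]; exact one_pos)
    fun r hr => hnn _ (sq_mem_Icc (R := R) hr)
  refine ⟨ν, τ, ⟨⟨1, le_rfl, hmem⟩, hlow⟩, ⟨hmem, fun μ hμ => hlow ⟨1, le_rfl, hμ⟩⟩,
    ⟨⟨⟨fun r => profile N 0 τ (r ^ 2), ?_⟩, by linarith⟩, ?_⟩, hντ, ⟨⟨?_, hν0⟩, ?_⟩,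
    fun r => r * g (r ^ 2), ?_, by simp, ?_, ?_, ?_, hmono, fun u => ⟨fun hu => ?_, ?_⟩⟩
  · have h1 : (fun x : E N => profile N 0 τ (‖x‖ ^ 2)) = modeFun (profile N 0 τ) 1 := by
      ext x; simp [modeFun, polyFun]
    have h2 := contDiff_profile hN 0 τ
    rw [h1]
    refine isNeumannEigenfunction_modeFun hR isHarmonic_one h2 hzτ (profile_ode hN 0 τ) ?_
    refine not_ae_eq_zero_of_continuous (contDiff_modeFun h2 1).continuous
      (mem_ball_self hR) ?_
    simp [modeFun, polyFun, profile_zero]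
  · rintro μ ⟨⟨f, hu⟩, hμ0⟩
    by_contra hμ
    have h1 : (fun x : E N => f ‖x‖) = polarProduct f (polyFun 1) := by
      ext x; simp [polarProduct, polyFun]
    rw [h1] at hu
    exact hu.1 ((hu.isVeryWeakSolution hR).polarProduct_ae_eq_zero hN
      (isSphericalHarmonic_polyFun isHarmonic_one) (hres0 μ (not_le.1 hμ) hμ0))
  · obtain ⟨f, Y, -, hu⟩ := hmem
    exact ⟨_, hu⟩
  · rintro μ ⟨⟨u, hu⟩, hμ0⟩
    by_contra hμ
    rw [not_le] at hμ
    have hv := hu.isVeryWeakSolution hR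
    -- For `μ < ν` and `μ ≠ 0` no mode is resonant, so an arbitrary eigenfunction, separated or not,
    -- would vanish.
    refine hu.1 (ae_eq_zero_of_orthogonal_harmonic hN hv.1 fun k P hP p =>
      hv.orthogonal_of_nonresonant hN hP ?_ p)
    rcases Nat.eq_zero_or_pos k with rfl | hk
    · exact hres0 μ (hμ.trans hντ) hμ0
    · exact hres1 k hk μ hμ
  · have h1 : ContDiff ℝ ∞ fun r : ℝ => r * g (r ^ 2) :=
      contDiff_id.mul (hgs.comp (contDiff_id.pow 2))
    exact (contDiff_infty.1 h1 2).contDiffOn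
  · rw [(hd R).hasDerivWithinAt.derivWithin ((uniqueDiffOn_Icc hR) R ⟨hR.le, le_rfl⟩), hz]
  · intro r hr
    have h1 : deriv (fun r => r * g (r ^ 2)) = fun r => neumannTrace 1 g (r ^ 2) :=
      funext fun r => (hd r).deriv
    have h2 := (hasDerivAt_second hgs 0 hgo hr.1.ne').deriv
    simp only [pow_zero, one_mul, zero_add, pow_one] at h2
    rw [h1, h2]
    push_cast
    have hr0 := hr.1.ne'
    field_simp
    ring
  · intro r hr
    exact mul_pos hr.1 (hpos _ (sq_mem_Icc ⟨hr.1.le, hr.2⟩))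
  · obtain ⟨c, hc⟩ := (hu.isVeryWeakSolution hR).ae_eq_modeFun hN hR hpos hz hresν
    have hP := isHarmonic_sum_smul_X c
    have h1 := polarProduct_mul_eq_modeFun hP.1 (fun _ _ => rfl) g
    refine ⟨polyFun (∑ i, c i • X i), isSphericalHarmonic_polyFun hP, ?_, by rw [h1]; exact hc⟩
    by_contra! hcon
    refine hu.1 (hc.trans (Filter.Eventually.of_forall fun x => ?_))
    have h2 := congrFun (polarProduct_mul_eq_modeFun hP.1
      (Y := fun _ => 0) (fun θ hθ => (hcon θ hθ).symm) g) x
    rw [← h2]; simp [polarProduct]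
  · rintro ⟨Y, hY, hne, hu⟩
    obtain ⟨P, hP, hYP⟩ := hY.exists_isHarmonic
    exact (heig P Y hP hYP hne).congr hu.symm
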